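/- **Setting.** Let $D\subset\mathbb R^d$, $d\ge 1$, be a nonempty bounded open set, and let $V=H^1_0(D)$ be the closure of $C_c^\infty(D)$ in the norm $(\|v\|_{L^2(D)}^2+\|\nabla v\|_{L^2(D)}^2)^{1/2}$. Let $U=[-\tfrac12,\tfrac12]^{\mathbb N}$ with the metric of $\ell^\infty$, let $a_j\in L^\infty(D)$ for $j\ge 0$, and put $a(y)=a(\cdot,y)=a_0+\sum_{j\ge1}y_j a_j$ for $y=(y_1,y_2,\dots)\in U$. Assume that * there are constants $0<a_{\min}<a_{\max}<\infty$ such that, for every $y\in U$, $a_{\min}\le a(x,y)\le a_{\max}$ for almost every $x\in D$; * $\sum_{j\ge1}\|a_j\|_{L^\infty(D)}^p<\infty$ for some $p\in(0,1)$. Consider, for $y\in U$, the variational eigenvalue problem of finding $\lambda\in\mathbb R$ and $0\ne u\in V$ with $$\int_D a(x,y)\,\nabla u\cdot\nabla v\,dx=\lambda\int_D u\,v\,dx\qquad\text{for all }v\in V .$$ **Statement.** For each $y\in U$ the eigenvalues of this problem, repeated according to multiplicity, form a sequence $0<\lambda_1(y)\le\lambda_2(y)\le\cdots$; likewise the eigenvalues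 of the Dirichlet Laplacian on $D$ (the same problem with $a\equiv1$) form a sequence $0<\chi_1\le\chi_2\le\cdots$. Moreover $\sum_{j\ge1}\|a_j\|_{L^\infty(D)}<\infty$, each $\lambda_k$, $k\ge1$, is Lipschitz continuous on $U$ with respect to the $\ell^\infty$ metric, and for all $k\ge1$ and $y,y'\in U$ $$|\lambda_k(y)-\lambda_k(y')|\;\le\;\frac{a_{\max}^2\chi_k^2}{a_{\min}^2\chi_1}\,\|a(y)-a(y')\|_{L^\infty(D)}\;\le\;\frac{a_{\max}^2\chi_k^2}{a_{\min}^2\chi_1}\Big(\sum_{j\ge1}\|a_j\|_{L^\infty(D)}\Big)\|y-y'\|_{\ell^\infty}.$$ -/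

import Mathlib

open MeasureTheory Set
open scoped ENNReal NNReal ContDiff Gradient

noncomputable section

namespace EllipticEVP

/-- The Euclidean space `ℝᵈ`. -/
abbrev Space (d : ℕ) : Type := EuclideanSpace ℝ (Fin d)

/-- The real Hilbert space `L²(D)`. -/
abbrev L2 {d : ℕ} (D : Set (Space d)) : Type := Lp ℝ 2 (volume.restrict D)

/-- The real Hilbert space `L²(D; ℝᵈ)` of square integrable vector fields. -/
abbrev L2Vec {d : ℕ} (D : Set (Space d)) : Type := Lp (Space d) 2 (volume.restrict D)

/-- The Banach space `L^∞(D)`. -/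
abbrev Linf {d : ℕ} (D : Set (Space d)) : Type := Lp ℝ ∞ (volume.restrict D)

/-- The Hilbert space `L²(D) × L²(D; ℝᵈ)` with `‖(u, g)‖² = ‖u‖² + ‖g‖²`; through `u ↦ (u, ∇u)`
the space `H¹(D)` with its usual norm is a closed subspace of it. -/
abbrev H1Ambient {d : ℕ} (D : Set (Space d)) : Type := WithLp 2 (L2 D × L2Vec D)

/-- `φ ∈ C_c^∞(D)`. -/
def IsTestFunction {d : ℕ} (D : Set (Space d)) (φ : Space d → ℝ) : Prop :=
  ContDiff ℝ ∞ φ ∧ HasCompactSupport φ ∧ tsupport φ ⊆ D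

/-- The subspace of all pairs `(φ, ∇φ)` with `φ ∈ C_c^∞(D)`. -/
def testGraph {d : ℕ} (D : Set (Space d)) : Submodule ℝ (H1Ambient D) where
  carrier := {p | ∃ φ : Space d → ℝ, IsTestFunction D φ ∧
    p.fst =ᵐ[volume.restrict D] φ ∧ p.snd =ᵐ[volume.restrict D] ∇ φ}
  zero_mem' := by
    refine ⟨fun _ => 0, ⟨contDiff_const, ?_, ?_⟩, ?_, ?_⟩
    · exact HasCompactSupport.zero
    · have h : tsupport (fun _ : Space d => (0 : ℝ)) = ∅ := tsupport_eq_empty_iff.2 rfl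
      rw [h]
      exact empty_subset D
    · exact Lp.coeFn_zero ℝ 2 _
    · rw [gradient_fun_const']
      exact Lp.coeFn_zero (Space d) 2 _
  add_mem' := by
    rintro p q ⟨φ, ⟨h1, h2, h3⟩, h4, h5⟩ ⟨ψ, ⟨k1, k2, k3⟩, k4, k5⟩
    refine ⟨φ + ψ, ⟨h1.add k1, h2.add k2, ?_⟩, ?_, ?_⟩
    · exact (tsupport_add φ ψ).trans (union_subset h3 k3)
    · exact (Lp.coeFn_add p.fst q.fst).trans (h4.add k4)
    · refine (Lp.coeFn_add p.snd q.snd).trans ((h5.add k5).trans (Filter.Eventually.of_forall ?_))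
      intro x
      have e := fderiv_add (h1.differentiable (by simp) x) (k1.differentiable (by simp) x)
      simp only [Pi.add_apply, gradient, e, map_add]
  smul_mem' := by
    rintro c p ⟨φ, ⟨h1, h2, h3⟩, h4, h5⟩
    refine ⟨c • φ, ⟨h1.const_smul c, h2.smul_left (f := fun _ => c), ?_⟩, ?_, ?_⟩
    · exact (tsupport_smul_subset_right (fun _ => c) φ).trans h3
    · exact (Lp.coeFn_smul c p.fst).trans (h4.const_smul c)
    · refine (Lp.coeFn_smul c p.snd).trans
        ((h5.const_smul c).trans (Filter.Eventually.of_forall ?_))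
      intro x
      have e := fderiv_const_smul (h1.differentiable (by simp) x) c
      simp only [Pi.smul_apply, gradient, e, map_smul]

/-- The Sobolev space `H¹₀(D)`: the closure of `C_c^∞(D)` in the norm
`(‖u‖²_{L²} + ‖∇u‖²_{L²})^{1/2}`.  An element is recorded as the pair of the function and its weak
gradient: a limit `(u, g)` of pairs `(φₙ, ∇φₙ)` inherits the integration by parts formula, so that
`g` is the weak gradient of `u`. -/
def H10 {d : ℕ} (D : Set (Space d)) : Submodule ℝ (H1Ambient D) := (testGraph D).topologicalClosure

/-- The `L²(D)` function underlying an element of `H¹₀(D)`. -/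
def fn {d : ℕ} {D : Set (Space d)} (u : H10 D) : L2 D := (u : H1Ambient D).fst

/-- The weak gradient of an element of `H¹₀(D)`. -/
def grad {d : ℕ} {D : Set (Space d)} (u : H10 D) : L2Vec D := (u : H1Ambient D).snd

theorem integrable_coeff_mul_inner {d : ℕ} {D : Set (Space d)} (a : Linf D) (f g : L2Vec D) :
    Integrable (fun x => a x * inner ℝ (f x) (g x)) (volume.restrict D) := by
  refine (L2.integrable_inner f g).bdd_mul (c := ‖a‖) (Lp.aestronglyMeasurable a) ?_
  have h := ae_le_eLpNormEssSup (f := a) (μ := volume.restrict D)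
  filter_upwards [h] with x hx
  rw [Lp.norm_def, eLpNorm_exponent_top]
  have h2 : eLpNormEssSup a (volume.restrict D) ≠ ⊤ := by
    rw [← eLpNorm_exponent_top]
    exact Lp.eLpNorm_ne_top a
  have h3 := ENNReal.toReal_mono h2 hx
  simpa using h3

/-- The bilinear form `(w, v) ↦ ∫_D a ∇w · ∇v dx` on `H¹₀(D)`. -/
def diffusionForm {d : ℕ} {D : Set (Space d)} (a : Linf D) : LinearMap.BilinForm ℝ (H10 D) :=
  LinearMap.mk₂ ℝ (fun w v => ∫ x in D, a x * inner ℝ (grad w x) (grad v x))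
    (by
      intro w w' v
      rw [← integral_add (integrable_coeff_mul_inner a _ _) (integrable_coeff_mul_inner a _ _)]
      refine integral_congr_ae ?_
      filter_upwards [Lp.coeFn_add (grad w) (grad w')] with x hx
      have e : grad (w + w') = (grad w) + (grad w') := rfl
      rw [e, hx, Pi.add_apply, inner_add_left, mul_add])
    (by
      intro c w v
      rw [smul_eq_mul, ← integral_const_mul]
      refine integral_congr_ae ?_
      filter_upwards [Lp.coeFn_smul c (grad w)] with x hx
      have e : grad (c • w) = c • (grad w) := rfl
      rw [e, hx, Pi.smul_apply, real_inner_smul_left]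
      ring)
    (by
      intro w v v'
      rw [← integral_add (integrable_coeff_mul_inner a _ _) (integrable_coeff_mul_inner a _ _)]
      refine integral_congr_ae ?_
      filter_upwards [Lp.coeFn_add (grad v) (grad v')] with x hx
      have e : grad (v + v') = (grad v) + (grad v') := rfl
      rw [e, hx, Pi.add_apply, inner_add_right, mul_add])
    (by
      intro c w v
      rw [smul_eq_mul, ← integral_const_mul]
      refine integral_congr_ae ?_
      filter_upwards [Lp.coeFn_smul c (grad v)] with x hx
      have e : grad (c • v) = c • (grad v) := rfl
      rw [e, hx, Pi.smul_apply, real_inner_smul_right]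
      ring)

/-- The Dirichlet form `(w, v) ↦ ∫_D ∇w · ∇v dx` on `H¹₀(D)`, i.e. the weak form of the Dirichlet
Laplacian. -/
def dirichletForm {d : ℕ} (D : Set (Space d)) : LinearMap.BilinForm ℝ (H10 D) :=
  LinearMap.mk₂ ℝ (fun w v => ∫ x in D, inner ℝ (grad w x) (grad v x))
    (fun w w' v => inner_add_left (𝕜 := ℝ) (grad w) (grad w') (grad v))
    (fun c w v => real_inner_smul_left (grad w) (grad v) c)
    (fun w v v' => inner_add_right (𝕜 := ℝ) (grad w) (grad v) (grad v'))
    (fun c w v => real_inner_smul_right (grad w) (grad v) c)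

/-- The space of all `u ∈ H¹₀(D)` with `B(u, v) = t ⟨u, v⟩_{L²(D)}` for every `v ∈ H¹₀(D)`; `t` is
an eigenvalue of the variational problem if and only if this space is nonzero. -/
def eigenspace {d : ℕ} {D : Set (Space d)} (B : LinearMap.BilinForm ℝ (H10 D)) (t : ℝ) :
    Submodule ℝ (H10 D) where
  carrier := {u | ∀ v : H10 D, B u v = t * inner ℝ (fn u) (fn v)}
  zero_mem' := by
    intro v
    have e : fn (0 : H10 D) = 0 := rfl
    simp [e]
  add_mem' := by
    intro u u' hu hu' v
    have e : fn (u + u') = (fn u) + (fn u') := rfl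
    rw [map_add, LinearMap.add_apply, hu v, hu' v, e, inner_add_left, mul_add]
  smul_mem' := by
    intro c u hu v
    have e : fn (c • u) = c • (fn u) := rfl
    rw [map_smul, LinearMap.smul_apply, hu v, e, real_inner_smul_left, smul_eq_mul]
    ring

/-- The `k`-th eigenvalue, `k = 1, 2, …`, of the variational problem `B(u, v) = t ⟨u, v⟩`, the
eigenvalues being listed in nondecreasing order and counted with multiplicity: the least `t` such
that the eigenfunctions with eigenvalue at most `t` span a space of dimension at least `k`. -/
def eigenvalue {d : ℕ} {D : Set (Space d)} (B : LinearMap.BilinForm ℝ (H10 D)) (k : ℕ) : ℝ :=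
  sInf {t : ℝ | (k : Cardinal) ≤ Module.rank ℝ ↥(⨆ s ∈ Iic t, eigenspace B s)}

/-- `lam 1 ≤ lam 2 ≤ …` is the list of all eigenvalues of the variational problem
`B(u, v) = t ⟨u, v⟩`, each repeated according to its multiplicity, and they are all positive. -/
structure IsOrderedEigenvalues {d : ℕ} {D : Set (Space d)} (B : LinearMap.BilinForm ℝ (H10 D))
    (lam : ℕ → ℝ) : Prop where
  pos : 0 < lam 1
  mono : ∀ k, 1 ≤ k → lam k ≤ lam (k + 1)
  multiplicity : ∀ t : ℝ,
    {k : ℕ | 1 ≤ k ∧ lam k = t}.encard = Cardinal.toENat (Module.rank ℝ (eigenspace B t))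

/-- The Banach space `ℓ^∞` of bounded real sequences. -/
abbrev SeqInf : Type := lp (fun _ : ℕ => ℝ) ∞

/-- The parameter domain `U = [-1/2, 1/2]^ℕ`, a subset of `ℓ^∞`. The sequence
`(y₁, y₂, …)` is indexed from zero, so that `y j` stands for `y_{j+1}`. -/
def paramDomain : Set SeqInf := {y | ∀ j : ℕ, y j ∈ Icc (-(1 / 2) : ℝ) (1 / 2)}

/-- The coefficient `a(·, y) = a₀ + ∑_{j ≥ 1} y_j a_j ∈ L^∞(D)`. -/
def coeff {d : ℕ} {D : Set (Space d)} (a : ℕ → Linf D) (y : SeqInf) : Linf D :=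
  a 0 + ∑' j : ℕ, y j • a (j + 1)

/-- The standing assumption on the affine coefficient built from `a_j ∈ L^∞(D)`: uniform bounds
`0 < a_min < a_max` and `p`-summability of the norms with `0 < p < 1`. -/
structure CoeffAssumption {d : ℕ} {D : Set (Space d)} (a : ℕ → Linf D) (amin amax p : ℝ) :
    Prop where
  amin_pos : 0 < amin
  amin_lt_amax : amin < amax
  bounds : ∀ y ∈ paramDomain, ∀ᵐ x ∂(volume.restrict D), amin ≤ coeff a y x ∧ coeff a y x ≤ amax
  p_pos : 0 < p
  p_lt_one : p < 1
  summable : Summable fun j : ℕ => ‖a (j + 1)‖ ^ p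

/-- `λ_k(y)`, the `k`-th eigenvalue of
`∫_D a(x, y) ∇u · ∇v dx = λ ∫_D u v dx` for all `v ∈ H¹₀(D)`. -/
def lam {d : ℕ} {D : Set (Space d)} (a : ℕ → Linf D) (k : ℕ) (y : SeqInf) : ℝ :=
  eigenvalue (diffusionForm (coeff a y)) k

/-- `χ_k`, the `k`-th eigenvalue of the Dirichlet Laplacian on `D`. -/
def chi {d : ℕ} (D : Set (Space d)) (k : ℕ) : ℝ := eigenvalue (dirichletForm D) k

end EllipticEVP

end

/-! The eigenvalues are controlled by a counting function. Let `E_t` be the span of the eigenvectors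
with eigenvalue at most `t`. The Rayleigh quotient `B(u,u)/‖u‖²` is at most `t` on `E_t`
(`apply_self_le_of_mem_spectralSubspace`) and exceeds `t` on its `L²`-orthogonal complement
(`lt_apply_self_of_forall_inner_eq_zero`, from the spectral theory of the compact solution
operator). Hence `dim E_t` is the largest dimension of a subspace on which the quotient is at most
`t`, and `λ_k ≤ t` holds exactly when `k ≤ dim E_t` (`weakEigenvalue_le_iff`). It follows that `B ≤
c B'` on the diagonal implies `λ_k(B) ≤ c λ_k(B')`.

For coefficients `a`, `b` one has `∫ a|∇u|² ≤ ∫ b|∇u|² + ‖a - b‖ ‖∇u‖² ≤ (1 + ‖a - b‖/a_min) ∫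
b|∇u|²`, so `λ_k(a) - λ_k(b) ≤ (‖a - b‖/a_min) λ_k(b)`. Comparison with the Dirichlet form gives
`λ_k(b) ≤ a_max χ_k`. The resulting constant `a_max χ_k / a_min` is at most the stated one, because
`a_max χ_k / (a_min χ_1) ≥ 1`.

The abstract theory needs a coercive form and a compact embedding. Poincaré's inequality and
Rellich's theorem both come from one estimate for the difference of a function and its translate. -/

noncomputable section

namespace EllipticEVP

/-! ### Energy forms and their spectral subspaces -/

section AbstractSpectralTheory

open Module

variable {H L : Type*} [NormedAddCommGroup H] [InnerProductSpace ℝ H]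
  [NormedAddCommGroup L] [InnerProductSpace ℝ L]

/-- A symmetric, bounded and coercive bilinear form on a real Hilbert space. -/
structure IsEnergyForm (B : LinearMap.BilinForm ℝ H) : Prop where
  symm : ∀ u v, B u v = B v u
  bounded : ∃ C : ℝ, 0 ≤ C ∧ ∀ u, B u u ≤ C * ‖u‖ ^ 2
  coercive : ∃ c : ℝ, 0 < c ∧ ∀ u, c * ‖u‖ ^ 2 ≤ B u u

namespace IsEnergyForm

variable {B : LinearMap.BilinForm ℝ H}

theorem self_nonneg (hB : IsEnergyForm B) (u : H) : 0 ≤ B u u := by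
  obtain ⟨c, hc, h⟩ := hB.coercive
  exact le_trans (by positivity) (h u)

theorem self_pos (hB : IsEnergyForm B) {u : H} (hu : u ≠ 0) : 0 < B u u := by
  obtain ⟨c, hc, h⟩ := hB.coercive
  have : 0 < ‖u‖ := norm_pos_iff.2 hu
  exact lt_of_lt_of_le (by positivity) (h u)

theorem sq_le (hB : IsEnergyForm B) (u v : H) : B u v ^ 2 ≤ B u u * B v v :=
  LinearMap.BilinForm.apply_sq_le_of_symm B hB.self_nonneg ⟨fun u v => hB.symm u v⟩ u v

/-- Cauchy–Schwarz for `B` extends the diagonal bound to all pairs, which makes `B` continuous as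
Lax–Milgram requires. -/
theorem exists_bound (hB : IsEnergyForm B) : ∃ C : ℝ, ∀ u v, ‖B u v‖ ≤ C * ‖u‖ * ‖v‖ := by
  obtain ⟨C, hC, h⟩ := hB.bounded
  refine ⟨C, fun u v => ?_⟩
  rw [Real.norm_eq_abs]
  refine abs_le_of_sq_le_sq ?_ (by positivity)
  calc B u v ^ 2 ≤ B u u * B v v := hB.sq_le u v
    _ ≤ (C * ‖u‖ ^ 2) * (C * ‖v‖ ^ 2) :=
        mul_le_mul (h u) (h v) (hB.self_nonneg v) (by positivity)
    _ = (C * ‖u‖ * ‖v‖) ^ 2 := by ring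

/-- The solution operator of `B(w, v) = ⟪f, v⟫`. -/
theorem exists_solution (hB : IsEnergyForm B) [CompleteSpace H] :
    ∃ S : H →L[ℝ] H, ∀ f v, B (S f) v = inner ℝ f v := by
  obtain ⟨C, hC⟩ := hB.exists_bound
  let Bc : H →L[ℝ] H →L[ℝ] ℝ := B.mkContinuous₂ C hC
  have hco : IsCoercive Bc := by
    obtain ⟨c, hc, h⟩ := hB.coercive
    exact ⟨c, hc, fun u => by simpa [Bc, sq, mul_assoc] using h u⟩
  refine ⟨hco.continuousLinearEquivOfBilin.symm, fun f v => ?_⟩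
  have := hco.continuousLinearEquivOfBilin_apply (hco.continuousLinearEquivOfBilin.symm f) v
  simpa [Bc] using this.symm

end IsEnergyForm

/-- The space of all `u` with `B(u, v) = t ⟪ι u, ι v⟫` for every `v`. -/
def weakEigenspace (ι : H →L[ℝ] L) (B : LinearMap.BilinForm ℝ H) (t : ℝ) : Submodule ℝ H where
  carrier := {u | ∀ v, B u v = t * inner ℝ (ι u) (ι v)}
  zero_mem' := by intro v; simp
  add_mem' := by
    intro u u' hu hu' v
    rw [map_add, LinearMap.add_apply, hu v, hu' v, map_add, inner_add_left, mul_add]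
  smul_mem' := by
    intro c u hu v
    rw [map_smul, LinearMap.smul_apply, hu v, map_smul, real_inner_smul_left, smul_eq_mul]
    ring

/-- The span of all eigenvectors with eigenvalue at most `t`. -/
def spectralSubspace (ι : H →L[ℝ] L) (B : LinearMap.BilinForm ℝ H) (t : ℝ) : Submodule ℝ H :=
  ⨆ s ∈ Iic t, weakEigenspace ι B s

/-- The `k`-th eigenvalue, counted with multiplicity. -/
def weakEigenvalue (ι : H →L[ℝ] L) (B : LinearMap.BilinForm ℝ H) (k : ℕ) : ℝ :=
  sInf {t : ℝ | (k : Cardinal) ≤ Module.rank ℝ (spectralSubspace ι B t)}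

variable {ι : H →L[ℝ] L} {B : LinearMap.BilinForm ℝ H}

theorem mem_weakEigenspace {t : ℝ} {u : H} :
    u ∈ weakEigenspace ι B t ↔ ∀ v, B u v = t * inner ℝ (ι u) (ι v) := Iff.rfl

theorem weakEigenspace_le_spectralSubspace {s t : ℝ} (h : s ≤ t) :
    weakEigenspace ι B s ≤ spectralSubspace ι B t :=
  le_iSup₂_of_le s h le_rfl

theorem spectralSubspace_mono : Monotone (spectralSubspace ι B) := fun _ _ h =>
  iSup₂_le fun _ hr => weakEigenspace_le_spectralSubspace (le_trans hr h)

theorem inner_eq_zero_of_mem_weakEigenspace (hB : IsEnergyForm B) {s t : ℝ} (hst : s ≠ t) {u v : H}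
    (hu : u ∈ weakEigenspace ι B s) (hv : v ∈ weakEigenspace ι B t) :
    inner ℝ (ι u) (ι v) = 0 := by
  have h1 := mem_weakEigenspace.1 hu v
  have h2 := mem_weakEigenspace.1 hv u
  rw [hB.symm v u, real_inner_comm, h1] at h2
  have : (s - t) * inner ℝ (ι u) (ι v) = 0 := by linarith
  exact (mul_eq_zero.1 this).resolve_left (sub_ne_zero.2 hst)

theorem inner_eq_zero_of_mem_spectralSubspace (hB : IsEnergyForm B) {s t : ℝ} (hst : s < t)
    {u v : H} (hu : u ∈ spectralSubspace ι B s) (hv : v ∈ weakEigenspace ι B t) :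
    inner ℝ (ι u) (ι v) = 0 := by
  -- Orthogonality to `ι v` cuts out a kernel, so it suffices to check it on each eigenspace.
  let W : Submodule ℝ H := LinearMap.ker ((innerₛₗ ℝ (ι v)).comp ι.toLinearMap)
  have hW : spectralSubspace ι B s ≤ W := by
    refine iSup₂_le fun r hr w hw => ?_
    have : inner ℝ (ι v) (ι w) = 0 := by
      rw [real_inner_comm]
      exact inner_eq_zero_of_mem_weakEigenspace hB (lt_of_le_of_lt hr hst).ne hw hv
    simpa [W] using this
  have := hW hu
  rw [real_inner_comm]
  simpa [W] using this

/-- The map `ι` need not be injective, but it is on an eigenspace, since there `B u u = t‖ι u‖²` and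
`B` is definite. -/
theorem eq_zero_of_mem_weakEigenspace (hB : IsEnergyForm B) {t : ℝ} {u : H}
    (hu : u ∈ weakEigenspace ι B t) (h : ι u = 0) : u = 0 := by
  by_contra hne
  have h1 := mem_weakEigenspace.1 hu u
  have h2 := hB.self_pos hne
  rw [h1, h] at h2
  simp at h2

theorem disjoint_spectralSubspace_weakEigenspace (hB : IsEnergyForm B) {s t : ℝ} (hst : s < t) :
    Disjoint (spectralSubspace ι B s) (weakEigenspace ι B t) := by
  rw [Submodule.disjoint_def]
  intro u hu hu'
  refine eq_zero_of_mem_weakEigenspace hB hu' ?_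
  exact inner_self_eq_zero.1 (inner_eq_zero_of_mem_spectralSubspace hB hst hu hu')

/-- On the span of eigenvectors with eigenvalue at most `t` the Rayleigh quotient is at most `t`. -/
theorem apply_self_le_of_mem_spectralSubspace (hB : IsEnergyForm B) {t : ℝ} {u : H}
    (hu : u ∈ spectralSubspace ι B t) : B u u ≤ t * ‖ι u‖ ^ 2 := by
  classical
  -- Write `u` as a finite sum of eigenvectors for distinct eigenvalues; the cross terms vanish both
  -- in `B` and in the inner product of `L`.
  obtain ⟨f, rfl⟩ := (Submodule.mem_biSup_iff_exists_dfinsupp (· ∈ Iic t) _ _).1 hu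
  set g := f.filter (· ∈ Iic t) with hg
  have hsum : DFinsupp.lsum ℕ (fun i => (weakEigenspace ι B i).subtype) g =
      ∑ s ∈ g.support, (g s : H) := by
    simp [DFinsupp.sumAddHom_apply, DFinsupp.sum]
  have hle : ∀ s ∈ g.support, s ≤ t := by
    intro s hs
    rw [hg, DFinsupp.support_filter, Finset.mem_filter] at hs
    exact hs.2
  rw [hsum]
  have hoff : ∀ s r, s ≠ r → inner ℝ (ι (g s)) (ι (g r)) = 0 := fun s r h =>
    inner_eq_zero_of_mem_weakEigenspace hB h (g s).2 (g r).2
  have e1 : B (∑ s ∈ g.support, (g s : H)) (∑ s ∈ g.support, (g s : H)) =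
      ∑ s ∈ g.support, s * ‖ι (g s)‖ ^ 2 := by
    rw [map_sum B, LinearMap.sum_apply]
    refine Finset.sum_congr rfl fun s hs => ?_
    rw [mem_weakEigenspace.1 (g s).2, map_sum, inner_sum,
      Finset.sum_eq_single_of_mem s hs (fun r _ hr => hoff s r hr.symm),
      real_inner_self_eq_norm_sq]
  have e2 : ‖ι (∑ s ∈ g.support, (g s : H))‖ ^ 2 = ∑ s ∈ g.support, ‖ι (g s)‖ ^ 2 := by
    rw [← real_inner_self_eq_norm_sq, map_sum, sum_inner]
    refine Finset.sum_congr rfl fun s hs => ?_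
    rw [inner_sum, Finset.sum_eq_single_of_mem s hs (fun r _ hr => hoff s r hr.symm),
      real_inner_self_eq_norm_sq]
  rw [e1, e2, Finset.mul_sum]
  exact Finset.sum_le_sum fun s hs => mul_le_mul_of_nonneg_right (hle s hs) (by positivity)

theorem spectralSubspace_eq_bot (hB : IsEnergyForm B) {t : ℝ} (ht : t ≤ 0) :
    spectralSubspace ι B t = ⊥ := by
  rw [Submodule.eq_bot_iff]
  intro u hu
  by_contra hne
  have h1 := apply_self_le_of_mem_spectralSubspace hB hu
  have h2 := hB.self_pos hne
  have : t * ‖ι u‖ ^ 2 ≤ 0 := mul_nonpos_of_nonpos_of_nonneg ht (by positivity)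
  linarith

/-- A subspace on which a compact operator is bounded below has finite dimension. -/
theorem finiteDimensional_of_isCompactOperator (hι : IsCompactOperator ι) (E : Submodule ℝ H)
    {C : ℝ} (hE : ∀ u ∈ E, ‖u‖ ≤ C * ‖ι u‖) : FiniteDimensional ℝ E := by
  by_contra hfin
  -- Riesz: infinite dimension gives a bounded sequence with mutual distances at least 1. A
  -- subsequence has Cauchy images under `ι`, and the lower bound carries this back to the sequence
  -- itself.
  obtain ⟨R, f, -, hfR, hsep⟩ := exists_seq_norm_le_one_le_norm_sub (𝕜 := ℝ) hfin
  obtain ⟨K, hK, hKsub⟩ := hι.image_closedBall_subset_compact (f := ι.toLinearMap) R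
  have hmem : ∀ n, ι (f n) ∈ K := fun n => hKsub ⟨f n, by simpa using hfR n, rfl⟩
  obtain ⟨a, -, φ, hφ, hlim⟩ := hK.tendsto_subseq hmem
  have hcau := hlim.cauchySeq
  have hCpos : 0 < C := by
    by_contra hC
    have h01 : 1 ≤ ‖f 0 - f 1‖ := hsep (show (0 : ℕ) ≠ 1 by norm_num)
    have h2 := hE _ (f 0 - f 1).2
    have h3 : C * ‖ι ((f 0 - f 1 : E) : H)‖ ≤ 0 :=
      mul_nonpos_of_nonpos_of_nonneg (not_lt.1 hC) (norm_nonneg _)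
    rw [Submodule.coe_norm] at h01
    linarith
  obtain ⟨N, hN⟩ := Metric.cauchySeq_iff.1 hcau (1 / C) (by positivity)
  have hd := hN N le_rfl (N + 1) (Nat.le_succ N)
  have h1 : 1 ≤ ‖f (φ N) - f (φ (N + 1))‖ := hsep (hφ.injective.ne (Nat.succ_ne_self N).symm)
  have h2 := hE _ (f (φ N) - f (φ (N + 1))).2
  rw [Submodule.coe_norm] at h1
  rw [dist_eq_norm] at hd
  simp only [Function.comp_apply, ← map_sub] at hd
  rw [lt_div_iff₀ hCpos] at hd
  simp only [Submodule.coe_sub] at h1 h2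
  change 1 ≤ ‖((f (φ N) : H) - f (φ (N + 1)))‖ at h1
  linarith

theorem finiteDimensional_spectralSubspace (hB : IsEnergyForm B) (hι : IsCompactOperator ι)
    (t : ℝ) : FiniteDimensional ℝ (spectralSubspace ι B t) := by
  obtain ⟨c, hc, h⟩ := hB.coercive
  -- The constant combines Rayleigh quotient and coercivity. For `t < 0` the root is 0 by convention
  -- and the bound still holds.
  refine finiteDimensional_of_isCompactOperator hι _ (C := √(t / c)) fun u hu => ?_
  have h1 := apply_self_le_of_mem_spectralSubspace hB hu
  have h2 : ‖u‖ ^ 2 ≤ t / c * ‖ι u‖ ^ 2 := by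
    rw [div_mul_eq_mul_div, le_div_iff₀ hc]
    linarith [h u]
  calc ‖u‖ = √(‖u‖ ^ 2) := (Real.sqrt_sq (norm_nonneg _)).symm
    _ ≤ √(t / c * ‖ι u‖ ^ 2) := Real.sqrt_le_sqrt h2
    _ = √(t / c) * ‖ι u‖ := by
        rw [Real.sqrt_mul' _ (by positivity), Real.sqrt_sq (norm_nonneg _)]

/-- A positive compact symmetric operator whose eigenvalues are all less than `m` has its quadratic
form bounded by `r‖f‖²` for some `r < m`. -/
theorem exists_inner_le_of_hasEigenvalue_lt {X : Type*} [NormedAddCommGroup X]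
    [InnerProductSpace ℝ X] [CompleteSpace X] (S : X →L[ℝ] X) (hS : IsCompactOperator S)
    (hsymm : S.IsSymmetric) (hpos : ∀ f, 0 ≤ inner ℝ (S f) f) {m : ℝ} (hm : 0 < m)
    (hlt : ∀ μ, End.HasEigenvalue (S : End ℝ X) μ → μ < m) :
    ∃ r < m, 0 ≤ r ∧ ∀ f, inner ℝ (S f) f ≤ r * ‖f‖ ^ 2 := by
  -- For self-adjoint `S` the norm is the spectral radius; if nonzero, it is attained at a spectral
  -- value, an eigenvalue by compactness and nonnegative by positivity.
  refine ⟨‖S‖, ?_, norm_nonneg _, fun f => ?_⟩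
  · by_cases hS0 : S = 0
    · simpa [hS0] using hm
    have hX : Nontrivial X := by
      by_contra hX
      rw [not_nontrivial_iff_subsingleton] at hX
      exact hS0 (ContinuousLinearMap.ext fun x => Subsingleton.elim _ _)
    -- Over `ℝ` this is not automatic: an empty spectrum would have spectral radius 0, forcing `‖S‖
    -- = 0`.
    have hne : (spectrum ℝ S).Nonempty := by
      by_contra hemp
      rw [Set.not_nonempty_iff_eq_empty] at hemp
      have h := S.spectralRadius_eq_nnnorm hsymm.isSelfAdjoint
      rw [spectralRadius, hemp] at h
      simp at h
      exact hS0 (nnnorm_eq_zero.1 h.symm)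
    obtain ⟨μ, hμ, hr⟩ := spectrum.exists_nnnorm_eq_spectralRadius_of_nonempty hne
    rw [S.spectralRadius_eq_nnnorm hsymm.isSelfAdjoint, ENNReal.coe_inj] at hr
    have hr' : |μ| = ‖S‖ := congrArg NNReal.toReal hr
    have hμ0 : μ ≠ 0 := by
      rintro rfl
      exact hS0 (norm_eq_zero.1 (by simpa using hr'.symm))
    have hev := (hS.hasEigenvalue_iff_mem_spectrum hμ0).2 hμ
    have hμnn : 0 ≤ μ := eigenvalue_nonneg_of_nonneg (𝕜 := ℝ) hev
      (fun x => by simpa [real_inner_comm] using hpos x)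
    rw [← hr', abs_of_nonneg hμnn]
    exact hlt μ hev
  · calc inner ℝ (S f) f ≤ ‖S f‖ * ‖f‖ := real_inner_le_norm _ _
      _ ≤ ‖S‖ * ‖f‖ * ‖f‖ := by gcongr; exact S.le_opNorm f
      _ = ‖S‖ * ‖f‖ ^ 2 := by ring

end AbstractSpectralTheory

/-! ### The min-max principle -/

section CourantFischer

open Module

variable {H L : Type*} [NormedAddCommGroup H] [InnerProductSpace ℝ H] [CompleteSpace H]
  [NormedAddCommGroup L] [InnerProductSpace ℝ L] [CompleteSpace L]
  {ι : H →L[ℝ] L} {B : LinearMap.BilinForm ℝ H}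

/-- On the complement of the span of the eigenvectors with eigenvalue at most `t` the Rayleigh
quotient exceeds `t`. -/
theorem lt_apply_self_of_forall_inner_eq_zero (hB : IsEnergyForm B) (hι : IsCompactOperator ι)
    {t : ℝ} {u : H} (hu : u ≠ 0)
    (horth : ∀ w ∈ spectralSubspace ι B t, inner ℝ (ι w) (ι u) = 0) :
    t * ‖ι u‖ ^ 2 < B u u := by
  rcases le_or_gt t 0 with ht | ht
  · have h1 : t * ‖ι u‖ ^ 2 ≤ 0 := mul_nonpos_of_nonpos_of_nonneg ht (by positivity)
    exact lt_of_le_of_lt h1 (hB.self_pos hu)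
  obtain ⟨S, hS⟩ := hB.exists_solution
  -- `R` solves `B(R f, v) = ⟪f, ι v⟫`. The operator `K = ι R` is compact, symmetric and positive,
  -- and its nonzero eigenvalues are the reciprocals of those of the variational problem.
  let R : L →L[ℝ] H := S.comp (ContinuousLinearMap.adjoint ι)
  have hR : ∀ f v, B (R f) v = inner ℝ f (ι v) := fun f v => by
    rw [ContinuousLinearMap.comp_apply, hS, ContinuousLinearMap.adjoint_inner_left]
  let K : L →L[ℝ] L := ι.comp R
  have hKR : ∀ f g, inner ℝ (K f) g = B (R f) (R g) := fun f g => by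
    rw [hB.symm, hR, real_inner_comm]; rfl
  have hKcomp : IsCompactOperator K := hι.comp_clm R
  have hKsymm : K.IsSymmetric := fun f g => by
    change inner ℝ (K f) g = inner ℝ f (K g)
    rw [hKR, real_inner_comm, hKR, hB.symm]
  have heig : ∀ (μ : ℝ) (f : L), μ ≠ 0 → K f = μ • f → R f ∈ weakEigenspace ι B μ⁻¹ := by
    intro μ f hμ hf v
    change _ = _ * inner ℝ (K f) _
    rw [hR, hf, real_inner_smul_left, inv_mul_cancel_left₀ hμ]
  -- The complement of `ι(E_t)` is invariant under `K`, so the spectral bound can be applied to the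
  -- restriction.
  let X : Submodule ℝ L := ((spectralSubspace ι B t).map ι.toLinearMap)ᗮ
  have hXmem : ∀ f, f ∈ X ↔ ∀ w ∈ spectralSubspace ι B t, inner ℝ (ι w) f = 0 := fun f => by
    simp only [X, Submodule.mem_orthogonal, Submodule.mem_map, forall_exists_index, and_imp,
      forall_apply_eq_imp_iff₂]
    rfl
  have hinv : ∀ f ∈ X, K f ∈ X := by
    intro f hf
    have hle : spectralSubspace ι B t ≤
        LinearMap.ker ((innerₛₗ ℝ (K f)).comp ι.toLinearMap) := by
      refine iSup₂_le fun r hr w hw => ?_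
      have hw' : inner ℝ (ι w) f = 0 :=
        (hXmem f).1 hf w (weakEigenspace_le_spectralSubspace hr hw)
      have e1 : B w (R f) = r * inner ℝ (ι w) (K f) := mem_weakEigenspace.1 hw (R f)
      rw [hB.symm, hR, real_inner_comm, hw'] at e1
      have e2 : inner ℝ (K f) (ι w) = 0 := by
        rcases eq_or_ne r 0 with rfl | hr0
        · have : w = 0 := by
            by_contra hne
            have h1 := mem_weakEigenspace.1 hw w
            have h2 := hB.self_pos hne
            rw [h1] at h2
            simp at h2
          simp [this]
        · rw [real_inner_comm]
          exact (mul_eq_zero.1 e1.symm).resolve_left hr0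
      simpa using e2
    rw [hXmem]
    intro w hw
    rw [real_inner_comm]
    simpa using hle hw
  let T : X →L[ℝ] X := K.restrict hinv
  have hTapp : ∀ f : X, ((T f : X) : L) = K f := fun f => rfl
  have hT : IsCompactOperator T := hKcomp.restrict' hinv
  have hTsymm : T.IsSymmetric := hKsymm.restrict_invariant hinv
  have hTpos : ∀ f, 0 ≤ inner ℝ (T f) f := fun f => by
    rw [Submodule.coe_inner, hTapp, hKR]
    exact hB.self_nonneg _
  -- An eigenvector `f ∈ X` with `μ ≥ 1/t` would give `R f ∈ E_t`, so that `ι (R f) = μ f` would be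
  -- orthogonal to `f`.
  have hlt : ∀ μ, End.HasEigenvalue (T : End ℝ X) μ → μ < t⁻¹ := by
    intro μ hμ
    by_contra hge
    rw [not_lt] at hge
    have hμpos : 0 < μ := lt_of_lt_of_le (inv_pos.2 ht) hge
    obtain ⟨f, hf⟩ := hμ.exists_hasEigenvector
    have hKf : K f = μ • (f : L) := by
      rw [← hTapp]
      exact congrArg Subtype.val hf.apply_eq_smul
    have h1 : R f ∈ spectralSubspace ι B t :=
      weakEigenspace_le_spectralSubspace (inv_le_of_inv_le₀ ht hge) (heig μ f hμpos.ne' hKf)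
    have h2 : inner ℝ (K f) (f : L) = 0 := (hXmem f).1 f.2 _ h1
    rw [hKf, real_inner_smul_left] at h2
    exact hf.2 (Subtype.ext (inner_self_eq_zero.1 ((mul_eq_zero.1 h2).resolve_left hμpos.ne')))
  obtain ⟨r, hrlt, hr0, hr⟩ :=
    exists_inner_le_of_hasEigenvalue_lt T hT hTsymm hTpos (inv_pos.2 ht) hlt
  set f : L := ι u with hfdef
  have hf : f ∈ X := (hXmem f).2 horth
  rcases eq_or_ne f 0 with hf0 | hf0
  · simpa [hf0] using hB.self_pos hu
  have hfpos : 0 < ‖f‖ ^ 2 := by have := norm_pos_iff.2 hf0; positivity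
  have h1 : inner ℝ (K f) f ≤ r * ‖f‖ ^ 2 := hr ⟨f, hf⟩
  -- With `f = ι u`, Cauchy–Schwarz for `B` gives `‖f‖⁴ = B(R f, u)² ≤ ⟪K f, f⟫ B(u,u)`. The strict
  -- inequality `r < 1/t` then makes the conclusion strict.
  have h2 : (‖f‖ ^ 2) ^ 2 ≤ (r * ‖f‖ ^ 2) * B u u := by
    have h3 := hB.sq_le (R f) u
    rw [hR, ← hfdef, real_inner_self_eq_norm_sq, ← hKR] at h3
    exact h3.trans (mul_le_mul_of_nonneg_right h1 (hB.self_nonneg u))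
  have h3 : ‖f‖ ^ 2 ≤ r * B u u := by
    have : ‖f‖ ^ 2 * ‖f‖ ^ 2 ≤ ‖f‖ ^ 2 * (r * B u u) := by nlinarith
    exact le_of_mul_le_mul_left this hfpos
  have h4 : t * r < 1 := by
    have := mul_lt_mul_of_pos_left hrlt ht
    rwa [mul_inv_cancel₀ ht.ne'] at this
  have h5 := hB.self_pos hu
  nlinarith

/-- The maximum principle behind the Courant–Fischer formula. -/
theorem finrank_le_finrank_spectralSubspace (hB : IsEnergyForm B) (hι : IsCompactOperator ι)
    {t : ℝ} (S : Submodule ℝ H) [FiniteDimensional ℝ S]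
    (hS : ∀ u ∈ S, B u u ≤ t * ‖ι u‖ ^ 2) :
    finrank ℝ S ≤ finrank ℝ (spectralSubspace ι B t) := by
  by_contra hlt
  rw [not_le] at hlt
  have := finiteDimensional_spectralSubspace hB hι t
  let E := spectralSubspace ι B t
  -- If `dim S > dim E`, pairing through `ι` has a kernel: a nonzero `u ∈ S` orthogonal to `E`,
  -- whose Rayleigh quotient exceeds `t`.
  let φ : S →ₗ[ℝ] Dual ℝ E :=
    (LinearMap.lcomp ℝ ℝ (ι.toLinearMap.comp E.subtype)).comp
      ((innerₛₗ ℝ).comp (ι.toLinearMap.comp S.subtype))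
  have hφ : ∀ (u : S) (w : E), φ u w = inner ℝ (ι u) (ι w) := fun u w => rfl
  have hker : LinearMap.ker φ ≠ ⊥ :=
    LinearMap.ker_ne_bot_of_finrank_lt (by rwa [Subspace.dual_finrank_eq])
  obtain ⟨u, hu, hne⟩ := Submodule.exists_mem_ne_zero_of_ne_bot hker
  have h := lt_apply_self_of_forall_inner_eq_zero (t := t) hB hι (u := u) (by simpa using hne)
    (fun w hw => by rw [real_inner_comm, ← hφ u ⟨w, hw⟩, LinearMap.mem_ker.1 hu]; rfl)
  exact absurd (hS u u.2) (not_le.2 h)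

/-- On a `k`-dimensional space where `ι` is injective the Rayleigh quotient is bounded, and the
maximum principle applies. This makes the set defining the `k`-th eigenvalue nonempty. -/
theorem exists_le_finrank_spectralSubspace (hB : IsEnergyForm B) (hι : IsCompactOperator ι)
    (hinf : ¬ FiniteDimensional ℝ (LinearMap.range ι.toLinearMap)) (k : ℕ) :
    ∃ t, k ≤ finrank ℝ (spectralSubspace ι B t) := by
  obtain ⟨f, hf⟩ : ∃ f : Fin k → LinearMap.range ι.toLinearMap, LinearIndependent ℝ f := by
    apply exists_linearIndependent_of_le_rank
    have : Cardinal.aleph0 ≤ Module.rank ℝ (LinearMap.range ι.toLinearMap) := by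
      rw [← not_lt]; exact fun h => hinf (Module.rank_lt_aleph0_iff.1 h)
    exact (Cardinal.natCast_lt_aleph0).le.trans this
  choose w hw using fun i => (f i).2
  have hιw : LinearIndependent ℝ (ι.toLinearMap ∘ w) := by
    have h : ι.toLinearMap ∘ w = Submodule.subtype _ ∘ f := funext hw
    rw [h]
    exact hf.map' (Submodule.subtype _) (Submodule.ker_subtype _)
  have hwi : LinearIndependent ℝ w := hιw.of_comp
  let S : Submodule ℝ H := Submodule.span ℝ (range w)
  have hfin : FiniteDimensional ℝ S := FiniteDimensional.span_of_finite ℝ (finite_range w)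
  have hinj : LinearMap.ker (ι.toLinearMap.comp S.subtype) = ⊥ := by
    rw [LinearMap.ker_eq_bot']
    rintro ⟨u, hu⟩ h0
    obtain ⟨c, rfl⟩ := (Submodule.mem_span_range_iff_exists_fun ℝ).1 hu
    have h1 : ∑ i, c i • (ι.toLinearMap ∘ w) i = 0 := by simpa using h0
    have h2 := Fintype.linearIndependent_iff.1 hιw c h1
    simp [h2]
  obtain ⟨K, -, hK⟩ := LinearMap.exists_antilipschitzWith _ hinj
  obtain ⟨C, hC, hBC⟩ := hB.bounded
  -- `C` bounds `B` above and `K` is the norm of the inverse of `ι` on `S`, so `C K²` bounds the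
  -- Rayleigh quotient.
  refine ⟨C * K ^ 2, ?_⟩
  have hrank : finrank ℝ S = k := by
    rw [finrank_span_eq_card hwi, Fintype.card_fin]
  rw [← hrank]
  refine finrank_le_finrank_spectralSubspace hB hι S fun u hu => ?_
  have h1 : ‖u‖ ≤ K * ‖ι u‖ := by
    have := hK.le_mul_dist ⟨u, hu⟩ 0
    simpa [dist_eq_norm] using this
  calc B u u ≤ C * ‖u‖ ^ 2 := hBC u
    _ ≤ C * (K * ‖ι u‖) ^ 2 := by gcongr
    _ = C * K ^ 2 * ‖ι u‖ ^ 2 := by ring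

end CourantFischer

/-! ### The counting function and the ordered list of eigenvalues -/

section WeakEigenvalues

open Module

variable {H L : Type*} [NormedAddCommGroup H] [InnerProductSpace ℝ H]
  [NormedAddCommGroup L] [InnerProductSpace ℝ L]
  {ι : H →L[ℝ] L} {B : LinearMap.BilinForm ℝ H}

theorem finrank_spectralSubspace_mono (hB : IsEnergyForm B) (hι : IsCompactOperator ι) :
    Monotone fun t => finrank ℝ (spectralSubspace ι B t) := fun _ t hst =>
  have := finiteDimensional_spectralSubspace hB hι t
  Submodule.finrank_mono (spectralSubspace_mono hst)

/-- Without growth in dimension the two spectral subspaces coincide, yet the eigenspace of `r` lies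
in the larger and is disjoint from the smaller. -/
theorem weakEigenspace_eq_bot_of_finrank_eq (hB : IsEnergyForm B) (hι : IsCompactOperator ι)
    {s r : ℝ} (hsr : s < r)
    (h : finrank ℝ (spectralSubspace ι B r) ≤ finrank ℝ (spectralSubspace ι B s)) :
    weakEigenspace ι B r = ⊥ := by
  have := finiteDimensional_spectralSubspace hB hι r
  have heq := Submodule.eq_of_le_of_finrank_le (spectralSubspace_mono (ι := ι) (B := B) hsr.le) h
  have hd := disjoint_spectralSubspace_weakEigenspace (ι := ι) hB hsr
  rw [heq] at hd
  exact (hd.eq_bot_of_ge (weakEigenspace_le_spectralSubspace le_rfl))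

/-- The spectral subspaces are continuous from the right. -/
theorem exists_spectralSubspace_eq_right (hB : IsEnergyForm B) (hι : IsCompactOperator ι) (t : ℝ) :
    ∃ r > t, spectralSubspace ι B r = spectralSubspace ι B t := by
  have hmono := finrank_spectralSubspace_mono hB hι
  -- Take `r > t` with the least dimension. For `t < s ≤ r`, any `q` between `t` and `s` already has
  -- that dimension, so `s` carries no eigenvector.
  obtain ⟨r, hr, hmin⟩ := exists_minimal_of_wellFoundedLT (fun n => n ∈
    (fun s => finrank ℝ (spectralSubspace ι B s)) '' Ioi t) ⟨_, t + 1, by simp, rfl⟩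
  obtain ⟨r, hrt, rfl⟩ := hr
  refine ⟨r, hrt, le_antisymm (iSup₂_le fun s hs => ?_) (spectralSubspace_mono (le_of_lt hrt))⟩
  rcases le_or_gt s t with hst | hst
  · exact weakEigenspace_le_spectralSubspace hst
  obtain ⟨q, hq1, hq2⟩ := exists_between hst
  have h1 := hmin ⟨q, hq1, rfl⟩ (hmono (hq2.le.trans hs))
  rw [weakEigenspace_eq_bot_of_finrank_eq hB hι hq2 ((hmono hs).trans h1)]
  exact bot_le

/-- To the left of `t` the spectral subspaces are eventually constant, and the eigenspace of `t`
is what is missing there. -/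
theorem exists_spectralSubspace_eq_sup (hB : IsEnergyForm B) (hι : IsCompactOperator ι) (t : ℝ) :
    ∃ r < t, (∀ s ∈ Ico r t, spectralSubspace ι B s = spectralSubspace ι B r) ∧
      spectralSubspace ι B t = spectralSubspace ι B r ⊔ weakEigenspace ι B t := by
  have hmono := finrank_spectralSubspace_mono hB hι
  -- The dimensions to the left of `t` are bounded by the one at `t`, so a greatest is attained at
  -- some `r < t`; no eigenvalue lies strictly between `r` and `t`.
  obtain ⟨n, hn, hmax⟩ := BddAbove.exists_isGreatest_of_nonempty
    (S := (fun s => finrank ℝ (spectralSubspace ι B s)) '' Iio t)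
    ⟨_, by rintro _ ⟨s, hs, rfl⟩; exact hmono (le_of_lt hs)⟩ ⟨_, t - 1, by simp, rfl⟩
  obtain ⟨r, hrt, rfl⟩ := hn
  have hbot : ∀ s ∈ Ioo r t, weakEigenspace ι B s = ⊥ := fun s hs =>
    weakEigenspace_eq_bot_of_finrank_eq hB hι hs.1 (hmax ⟨s, hs.2, rfl⟩)
  have hle : ∀ s < t, weakEigenspace ι B s ≤ spectralSubspace ι B r := by
    intro s hs
    rcases le_or_gt s r with h | h
    · exact weakEigenspace_le_spectralSubspace h
    · rw [hbot s ⟨h, hs⟩]; exact bot_le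
  refine ⟨r, hrt, fun s hs => ?_, ?_⟩
  · exact le_antisymm (iSup₂_le fun q hq => hle q (lt_of_le_of_lt hq hs.2))
      (spectralSubspace_mono hs.1)
  · refine le_antisymm (iSup₂_le fun q hq => ?_)
      (sup_le (spectralSubspace_mono (le_of_lt hrt)) (weakEigenspace_le_spectralSubspace le_rfl))
    rcases eq_or_lt_of_le (show q ≤ t from hq) with rfl | h
    · exact le_sup_right
    · exact (hle q h).trans le_sup_left

variable [CompleteSpace H] [CompleteSpace L]

/-- Right continuity makes the infimum attained. For `k = 0` the set is all of `ℝ` and its infimum a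
default value, hence `1 ≤ k`. -/
theorem weakEigenvalue_le_iff (hB : IsEnergyForm B) (hι : IsCompactOperator ι)
    (hinf : ¬ FiniteDimensional ℝ (LinearMap.range ι.toLinearMap)) {k : ℕ} (hk : 1 ≤ k) {t : ℝ} :
    weakEigenvalue ι B k ≤ t ↔ k ≤ finrank ℝ (spectralSubspace ι B t) := by
  have hmono := finrank_spectralSubspace_mono hB hι
  have hset : {t : ℝ | (k : Cardinal) ≤ Module.rank ℝ (spectralSubspace ι B t)} =
      {t : ℝ | k ≤ finrank ℝ (spectralSubspace ι B t)} := by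
    ext s
    have := finiteDimensional_spectralSubspace hB hι s
    rw [mem_ofPred_eq, mem_ofPred_eq, ← finrank_eq_rank, Nat.cast_le]
  have hbdd : BddBelow {t : ℝ | k ≤ finrank ℝ (spectralSubspace ι B t)} := by
    refine ⟨0, fun s hs => ?_⟩
    by_contra h
    rw [mem_ofPred_eq, spectralSubspace_eq_bot hB (not_le.1 h).le, finrank_bot] at hs
    omega
  rw [weakEigenvalue, hset]
  refine ⟨fun h => ?_, fun h => csInf_le hbdd h⟩
  refine le_trans ?_ (hmono h)
  obtain ⟨r, hr, heq⟩ := exists_spectralSubspace_eq_right hB hι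
    (sInf {t : ℝ | k ≤ finrank ℝ (spectralSubspace ι B t)})
  change k ≤ finrank ℝ (spectralSubspace ι B _)
  rw [← heq]
  obtain ⟨s, hs, hsr⟩ := exists_lt_of_csInf_lt
    (exists_le_finrank_spectralSubspace hB hι hinf k) hr
  exact le_trans hs (hmono hsr.le)

theorem weakEigenvalue_pos (hB : IsEnergyForm B) (hι : IsCompactOperator ι)
    (hinf : ¬ FiniteDimensional ℝ (LinearMap.range ι.toLinearMap)) {k : ℕ} (hk : 1 ≤ k) :
    0 < weakEigenvalue ι B k := by
  by_contra h
  rw [not_lt, weakEigenvalue_le_iff hB hι hinf hk, spectralSubspace_eq_bot hB le_rfl,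
    finrank_bot] at h
  omega

theorem weakEigenvalue_mono (hB : IsEnergyForm B) (hι : IsCompactOperator ι)
    (hinf : ¬ FiniteDimensional ℝ (LinearMap.range ι.toLinearMap)) {j k : ℕ} (hj : 1 ≤ j)
    (hjk : j ≤ k) : weakEigenvalue ι B j ≤ weakEigenvalue ι B k := by
  rw [weakEigenvalue_le_iff hB hι hinf hj]
  exact hjk.trans ((weakEigenvalue_le_iff hB hι hinf (hj.trans hjk)).1 le_rfl)

/-- For `r` just left of `t`, the indices with `λ_k = t` are those in `(dim E_r, dim E_t]`; their
number is the dimension of the eigenspace because `E_t` is the direct sum of `E_r` and it. -/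
theorem encard_weakEigenvalue_eq (hB : IsEnergyForm B) (hι : IsCompactOperator ι)
    (hinf : ¬ FiniteDimensional ℝ (LinearMap.range ι.toLinearMap)) (t : ℝ) :
    {k : ℕ | 1 ≤ k ∧ weakEigenvalue ι B k = t}.encard =
      Cardinal.toENat (Module.rank ℝ (weakEigenspace ι B t)) := by
  obtain ⟨r, hrt, hconst, hsup⟩ := exists_spectralSubspace_eq_sup hB hι t
  have hr := finiteDimensional_spectralSubspace hB hι r
  have ht := finiteDimensional_spectralSubspace hB hι t
  have he : FiniteDimensional ℝ (weakEigenspace ι B t) :=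
    Submodule.finiteDimensional_of_le (weakEigenspace_le_spectralSubspace (le_refl t))
  have hdim := Submodule.finrank_sup_add_finrank_inf_eq
    (spectralSubspace ι B r) (weakEigenspace ι B t)
  rw [← hsup, (disjoint_spectralSubspace_weakEigenspace hB hrt).eq_bot, finrank_bot,
    add_zero] at hdim
  have hset : {k : ℕ | 1 ≤ k ∧ weakEigenvalue ι B k = t} =
      (Finset.Ioc (finrank ℝ (spectralSubspace ι B r)) (finrank ℝ (spectralSubspace ι B t)) :
        Set ℕ) := by
    ext k
    rw [mem_ofPred_eq, Finset.coe_Ioc, mem_Ioc]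
    constructor
    · rintro ⟨hk, rfl⟩
      refine ⟨?_, (weakEigenvalue_le_iff hB hι hinf hk).1 le_rfl⟩
      by_contra h
      exact absurd ((weakEigenvalue_le_iff hB hι hinf hk).2 (not_lt.1 h)) (not_le.2 hrt)
    · rintro ⟨h1, h2⟩
      have hk : 1 ≤ k := by omega
      refine ⟨hk, le_antisymm ((weakEigenvalue_le_iff hB hι hinf hk).2 h2) ?_⟩
      by_contra h
      rw [not_le] at h
      -- Were `λ_k < t`, this point of `[r, t)` would have `dim ≥ k`, against constancy on that
      -- interval.
      have hm : max r (weakEigenvalue ι B k) ∈ Ico r t := ⟨le_max_left _ _, max_lt hrt h⟩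
      have := (weakEigenvalue_le_iff hB hι hinf hk).1 (le_max_right r (weakEigenvalue ι B k))
      rw [hconst _ hm] at this
      omega
  rw [hset, Set.encard_coe_eq_coe_finsetCard, Nat.card_Ioc, ← finrank_eq_rank,
    Cardinal.toENat_nat]
  congr 1
  omega

/-- Monotonicity of the eigenvalues in the form, a consequence of the min-max principle. -/
theorem weakEigenvalue_le_mul {B' : LinearMap.BilinForm ℝ H} (hB : IsEnergyForm B)
    (hB' : IsEnergyForm B') (hι : IsCompactOperator ι)
    (hinf : ¬ FiniteDimensional ℝ (LinearMap.range ι.toLinearMap)) {k : ℕ} (hk : 1 ≤ k) {c : ℝ}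
    (hc : 0 ≤ c) (hle : ∀ u, B u u ≤ c * B' u u) :
    weakEigenvalue ι B k ≤ c * weakEigenvalue ι B' k := by
  rw [weakEigenvalue_le_iff hB hι hinf hk]
  refine ((weakEigenvalue_le_iff hB' hι hinf hk).1 le_rfl).trans ?_
  have := finiteDimensional_spectralSubspace hB' hι (weakEigenvalue ι B' k)
  -- The trial space is the spectral subspace of `B'` at its own `k`-th eigenvalue.
  refine finrank_le_finrank_spectralSubspace hB hι _ fun u hu => ?_
  rw [mul_assoc]
  exact (hle u).trans
    (mul_le_mul_of_nonneg_left (apply_self_le_of_mem_spectralSubspace hB' hu) hc)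

end WeakEigenvalues

/-! ### The translation estimate and Poincaré's inequality -/

section TranslationEstimate

theorem sq_lintegral_le {α : Type*} [MeasurableSpace α] (μ : Measure α) {f : α → ℝ≥0∞}
    (hf : AEMeasurable f μ) : (∫⁻ x, f x ∂μ) ^ 2 ≤ μ univ * ∫⁻ x, f x ^ 2 ∂μ := by
  have h := ENNReal.lintegral_mul_le_Lp_mul_Lq μ Real.HolderConjugate.two_two hf
    (aemeasurable_const (b := (1 : ℝ≥0∞)))
  simp only [Pi.mul_apply, mul_one, ENNReal.one_rpow, lintegral_const, one_mul] at h
  calc (∫⁻ x, f x ∂μ) ^ 2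
      ≤ ((∫⁻ x, f x ^ (2 : ℝ) ∂μ) ^ (1 / 2 : ℝ) * μ univ ^ (1 / 2 : ℝ)) ^ 2 := by gcongr
    _ = μ univ * ∫⁻ x, f x ^ 2 ∂μ := by
        rw [mul_pow, ← ENNReal.rpow_natCast, ← ENNReal.rpow_natCast, ← ENNReal.rpow_mul,
          ← ENNReal.rpow_mul]
        norm_num [mul_comm]

variable {d : ℕ} {φ : Space d → ℝ}

theorem continuous_gradient (hφ : ContDiff ℝ ∞ φ) : Continuous (∇ φ) :=
  (InnerProductSpace.toDual ℝ (Space d)).symm.continuous.comp (hφ.continuous_fderiv (by simp))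

/-- The fundamental theorem of calculus along the segment from `x` to `x + z`, then Cauchy–Schwarz
in `t`. -/
theorem enorm_sub_sq_le (hφ : ContDiff ℝ ∞ φ) (x z : Space d) :
    ‖φ (x + z) - φ x‖ₑ ^ 2 ≤
      ‖z‖ₑ ^ 2 * ∫⁻ t in Ioc (0 : ℝ) 1, ‖∇ φ (x + t • z)‖ₑ ^ 2 := by
  have hgc : Continuous fun t : ℝ => ∇ φ (x + t • z) :=
    (continuous_gradient hφ).comp (by fun_prop)
  have hder : ∀ t : ℝ, HasDerivAt (fun t : ℝ => φ (x + t • z)) (inner ℝ (∇ φ (x + t • z)) z) t := by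
    intro t
    rw [inner_gradient_left]
    have h1 : HasDerivAt (fun t : ℝ => x + t • z) z t := by
      simpa using ((hasDerivAt_id t).smul_const z).const_add x
    exact ((hφ.differentiable (by simp) _).hasFDerivAt).comp_hasDerivAt t h1
  have hcont : Continuous fun t : ℝ => inner ℝ (∇ φ (x + t • z)) z := hgc.inner continuous_const
  have hint := intervalIntegral.integral_eq_sub_of_hasDerivAt (a := 0) (b := 1)
    (fun t _ => hder t) (hcont.intervalIntegrable 0 1)
  simp only [one_smul, zero_smul, add_zero] at hint
  rw [← hint, intervalIntegral.integral_of_le zero_le_one]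
  have hm : Measurable fun t : ℝ => ‖∇ φ (x + t • z)‖ₑ := hgc.enorm.measurable
  calc ‖∫ t in Ioc (0 : ℝ) 1, inner ℝ (∇ φ (x + t • z)) z‖ₑ ^ 2
      ≤ (∫⁻ t in Ioc (0 : ℝ) 1, ‖z‖ₑ * ‖∇ φ (x + t • z)‖ₑ) ^ 2 := by
        gcongr
        refine (enorm_integral_le_lintegral_enorm _).trans (lintegral_mono fun t => ?_)
        rw [mul_comm, ← ofReal_norm, ← ofReal_norm, ← ofReal_norm,
          ← ENNReal.ofReal_mul (norm_nonneg _)]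
        exact ENNReal.ofReal_le_ofReal (norm_inner_le_norm _ _)
    _ = ‖z‖ₑ ^ 2 * (∫⁻ t in Ioc (0 : ℝ) 1, ‖∇ φ (x + t • z)‖ₑ) ^ 2 := by
        rw [lintegral_const_mul _ hm, mul_pow]
    _ ≤ ‖z‖ₑ ^ 2 * ∫⁻ t in Ioc (0 : ℝ) 1, ‖∇ φ (x + t • z)‖ₑ ^ 2 := by
        gcongr
        refine (sq_lintegral_le _ hm.aemeasurable).trans (le_of_eq ?_)
        simp

/-- Tonelli and translation invariance remove the shift. A long `z` yields Poincaré's inequality,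
short ones yield compactness. -/
theorem lintegral_translate_sub_sq_le (hφ : ContDiff ℝ ∞ φ) (z : Space d) :
    ∫⁻ x, ‖φ (x + z) - φ x‖ₑ ^ 2 ≤ ‖z‖ₑ ^ 2 * ∫⁻ x, ‖∇ φ x‖ₑ ^ 2 := by
  have hc : Continuous fun q : Space d × ℝ => ‖∇ φ (q.1 + q.2 • z)‖ₑ ^ 2 :=
    (ENNReal.continuous_pow 2).comp ((continuous_gradient hφ).comp (by fun_prop)).enorm
  calc ∫⁻ x, ‖φ (x + z) - φ x‖ₑ ^ 2
      ≤ ∫⁻ x, ‖z‖ₑ ^ 2 * ∫⁻ t in Ioc (0 : ℝ) 1, ‖∇ φ (x + t • z)‖ₑ ^ 2 :=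
        lintegral_mono fun x => enorm_sub_sq_le hφ x z
    _ = ‖z‖ₑ ^ 2 * ∫⁻ x, ∫⁻ t in Ioc (0 : ℝ) 1, ‖∇ φ (x + t • z)‖ₑ ^ 2 := by
        rw [lintegral_const_mul _ hc.measurable.lintegral_prod_right]
    _ = ‖z‖ₑ ^ 2 * ∫⁻ t in Ioc (0 : ℝ) 1, ∫⁻ x, ‖∇ φ (x + t • z)‖ₑ ^ 2 := by
        rw [lintegral_lintegral_swap hc.measurable.aemeasurable]
    _ = ‖z‖ₑ ^ 2 * ∫⁻ x, ‖∇ φ x‖ₑ ^ 2 := by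
        congr 1
        calc ∫⁻ t in Ioc (0 : ℝ) 1, ∫⁻ x, ‖∇ φ (x + t • z)‖ₑ ^ 2
            = ∫⁻ t in Ioc (0 : ℝ) 1, ∫⁻ x, ‖∇ φ x‖ₑ ^ 2 :=
              lintegral_congr fun t =>
                lintegral_add_right_eq_self (fun x => ‖∇ φ x‖ₑ ^ 2) (t • z)
          _ = ∫⁻ x, ‖∇ φ x‖ₑ ^ 2 := by simp

variable {D : Set (Space d)}

theorem IsTestFunction.eq_zero (hφ : IsTestFunction D φ) {x : Space d} (hx : x ∉ D) : φ x = 0 :=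
  image_eq_zero_of_notMem_tsupport fun h => hx (hφ.2.2 h)

theorem IsTestFunction.gradient_eq_zero (hφ : IsTestFunction D φ) {x : Space d} (hx : x ∉ D) :
    ∇ φ x = 0 := by
  have h : fderiv ℝ φ x = 0 := by
    by_contra hne
    exact hx (hφ.2.2 (support_fderiv_subset ℝ hne))
  rw [gradient, h, map_zero]

/-- The Poincaré inequality for test functions. -/
theorem exists_poincare_const (hd : 1 ≤ d) (hD : Bornology.IsBounded D) :
    ∃ C : ℝ≥0, ∀ φ : Space d → ℝ, IsTestFunction D φ →
      ∫⁻ x in D, ‖φ x‖ₑ ^ 2 ≤ (C : ℝ≥0∞) ^ 2 * ∫⁻ x, ‖∇ φ x‖ₑ ^ 2 := by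
  obtain ⟨R, hR⟩ := hD.subset_closedBall 0
  -- A shift longer than the diameter moves `D` off itself, so `φ (x + z) = 0` on `D`. The absolute
  -- value is needed because `R` has no prescribed sign.
  let z : Space d := EuclideanSpace.single ⟨0, hd⟩ (2 * |R| + 1)
  have hz : ‖z‖ = 2 * |R| + 1 := by
    rw [PiLp.norm_single, Real.norm_eq_abs, abs_of_pos (by positivity)]
  have hzD : ∀ x ∈ D, x + z ∉ D := by
    intro x hx hxz
    have h1 : ‖x‖ ≤ R := by simpa using hR hx
    have h2 : ‖x + z‖ ≤ R := by simpa using hR hxz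
    have h3 : ‖z‖ ≤ ‖x + z‖ + ‖x‖ := by
      simpa using norm_sub_le (x + z) x
    linarith [le_abs_self R, abs_nonneg R]
  refine ⟨‖z‖₊, fun φ hφ => ?_⟩
  calc ∫⁻ x in D, ‖φ x‖ₑ ^ 2 ≤ ∫⁻ x in D, ‖φ (x + z) - φ x‖ₑ ^ 2 := by
        refine setLIntegral_mono ?_ fun x hx => ?_
        · have := hφ.1.continuous.measurable
          fun_prop
        · rw [hφ.eq_zero (hzD x hx), zero_sub, enorm_neg]
    _ ≤ ∫⁻ x, ‖φ (x + z) - φ x‖ₑ ^ 2 := setLIntegral_le_lintegral _ _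
    _ ≤ _ := lintegral_translate_sub_sq_le hφ.1 z

end TranslationEstimate

/-! ### Cubical grids -/

section Grid

variable {d : ℕ}

/-- The index of the cell of side length `h` that contains `x`. -/
def gridIndex (h : ℝ) (x : Space d) : Fin d → ℤ := fun i => ⌊x i / h⌋

/-- The half-open cube of side length `h` with index `m`. -/
def gridCell (h : ℝ) (m : Fin d → ℤ) : Set (Space d) := gridIndex h ⁻¹' {m}

theorem mem_gridCell {h : ℝ} {m : Fin d → ℤ} {x : Space d} :
    x ∈ gridCell h m ↔ gridIndex h x = m := Iff.rfl

theorem measurable_gridIndex (h : ℝ) : Measurable (gridIndex h : Space d → Fin d → ℤ) := by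
  refine measurable_pi_lambda _ fun i => Int.measurable_floor.comp ?_
  have : Measurable fun x : Space d => x i := by fun_prop
  exact this.div_const h

theorem measurableSet_gridCell (h : ℝ) (m : Fin d → ℤ) : MeasurableSet (gridCell h m) :=
  measurable_gridIndex h (measurableSet_singleton m)

theorem gridCell_eq {h : ℝ} (hh : 0 < h) (m : Fin d → ℤ) :
    gridCell h m = (WithLp.ofLp : Space d → Fin d → ℝ) ⁻¹'
      (univ.pi fun i => Ico (h * m i) (h * (m i + 1))) := by
  ext x
  simp only [mem_gridCell, funext_iff, gridIndex, mem_preimage, mem_univ_pi, mem_Ico,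
    Int.floor_eq_iff, le_div_iff₀ hh, div_lt_iff₀ hh, mul_comm h]

theorem volume_gridCell {h : ℝ} (hh : 0 < h) (m : Fin d → ℤ) :
    volume (gridCell h m) = ENNReal.ofReal h ^ d := by
  rw [gridCell_eq hh, (PiLp.volume_preserving_ofLp (Fin d)).measure_preimage
    (MeasurableSet.univ_pi fun i => measurableSet_Ico).nullMeasurableSet, Real.volume_pi_Ico]
  simp [mul_add]

theorem norm_sub_le_of_mem_gridCell {h : ℝ} (hh : 0 < h) {m : Fin d → ℤ} {x y : Space d}
    (hx : x ∈ gridCell h m) (hy : y ∈ gridCell h m) : ‖y - x‖ ≤ h * √d := by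
  rw [gridCell_eq hh] at hx hy
  have hi : ∀ i, ‖(y - x) i‖ ^ 2 ≤ h ^ 2 := by
    intro i
    have h1 := hx i (mem_univ i)
    have h2 := hy i (mem_univ i)
    simp only [mem_Ico] at h1 h2
    rw [Real.norm_eq_abs]
    refine pow_le_pow_left₀ (abs_nonneg _) ?_ 2
    rw [PiLp.sub_apply, abs_le]
    constructor <;> linarith
  rw [EuclideanSpace.norm_eq]
  calc √(∑ i, ‖(y - x) i‖ ^ 2) ≤ √(∑ _i : Fin d, h ^ 2) :=
        Real.sqrt_le_sqrt (Finset.sum_le_sum fun i _ => hi i)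
    _ = h * √d := by
        rw [Finset.sum_const, Finset.card_univ, Fintype.card_fin, nsmul_eq_mul, mul_comm,
          Real.sqrt_mul (by positivity), Real.sqrt_sq hh.le]

theorem finite_gridIndex_image {h : ℝ} (hh : 0 < h) {D : Set (Space d)}
    (hD : Bornology.IsBounded D) : (gridIndex h '' D).Finite := by
  obtain ⟨R, hR⟩ := hD.subset_closedBall 0
  refine (Set.finite_Icc (fun _ : Fin d => ⌊-R / h⌋) (fun _ => ⌊R / h⌋)).subset ?_
  rintro _ ⟨x, hx, rfl⟩
  have h1 : ‖x‖ ≤ R := by simpa using hR hx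
  have h2 : ∀ i, -R ≤ x i ∧ x i ≤ R := fun i =>
    abs_le.1 ((PiLp.norm_apply_le x i).trans h1)
  exact ⟨fun i => Int.floor_le_floor (div_le_div_of_nonneg_right (h2 i).1 hh.le),
    fun i => Int.floor_le_floor (div_le_div_of_nonneg_right (h2 i).2 hh.le)⟩

end Grid

/-! ### Approximation by cell averages and Rellich's theorem -/

section Rellich

variable {d : ℕ} {D : Set (Space d)} {φ : Space d → ℝ}

theorem enorm_sq_eq_lintegral {α E : Type*} [MeasurableSpace α] {μ : Measure α}
    [NormedAddCommGroup E] (f : Lp E 2 μ) : ‖f‖ₑ ^ 2 = ∫⁻ x, ‖f x‖ₑ ^ 2 ∂μ := by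
  have h := eLpNorm_nnreal_pow_eq_lintegral (f := f) (μ := μ) (p := 2) (by norm_num)
  rw [Lp.enorm_def]
  simpa using h

theorem IsTestFunction.lintegral_gradient (hφ : IsTestFunction D φ) (hD : IsOpen D) :
    ∫⁻ x in D, ‖∇ φ x‖ₑ ^ 2 = ∫⁻ x, ‖∇ φ x‖ₑ ^ 2 := by
  rw [← lintegral_indicator hD.measurableSet]
  refine lintegral_congr fun x => ?_
  by_cases hx : x ∈ D
  · rw [indicator_of_mem hx]
  · rw [indicator_of_notMem hx, hφ.gradient_eq_zero hx]
    simp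

theorem IsTestFunction.enorm_grad_sq (hφ : IsTestFunction D φ) (hD : IsOpen D) {g : L2Vec D}
    (hg : g =ᵐ[volume.restrict D] ∇ φ) : ‖g‖ₑ ^ 2 = ∫⁻ x, ‖∇ φ x‖ₑ ^ 2 := by
  rw [enorm_sq_eq_lintegral, ← hφ.lintegral_gradient hD]
  refine lintegral_congr_ae ?_
  filter_upwards [hg] with x hx
  rw [hx]

theorem volume_restrict_gridCell_ne_top {h : ℝ} (hh : 0 < h) (m : Fin d → ℤ) :
    volume.restrict D (gridCell h m) ≠ ⊤ := by
  refine ne_top_of_le_ne_top ?_ (Measure.restrict_apply_le D _)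
  rw [volume_gridCell hh]
  exact ENNReal.pow_ne_top ENNReal.ofReal_ne_top

/-- The indicator function of a grid cell in `L²(D)`. -/
def cellIndicator (D : Set (Space d)) {h : ℝ} (hh : 0 < h) (m : Fin d → ℤ) : L2 D :=
  indicatorConstLp 2 (measurableSet_gridCell h m) (volume_restrict_gridCell_ne_top hh m) (1 : ℝ)

/-- The finite rank operator which replaces a function by its averages over the cells of a grid. -/
def cellAverage (D : Set (Space d)) {h : ℝ} (hh : 0 < h) (F : Finset (Fin d → ℤ)) :
    L2 D →L[ℝ] L2 D :=
  ∑ m ∈ F, (h ^ d)⁻¹ • (innerSL ℝ (cellIndicator D hh m)).smulRight (cellIndicator D hh m)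

theorem isCompactOperator_cellAverage {h : ℝ} (hh : 0 < h) (F : Finset (Fin d → ℤ)) :
    IsCompactOperator (cellAverage D hh F) := by
  have h : cellAverage D hh F ∈ compactOperator (RingHom.id ℝ) (L2 D) (L2 D) := by
    refine Submodule.sum_mem _ fun m _ => Submodule.smul_mem _ _ ?_
    have h1 : IsCompactOperator (innerSL ℝ (cellIndicator D hh m)) :=
      isCompactOperator_of_locallyCompactSpace_dom _
    exact h1.clm_comp (ContinuousLinearMap.toSpanSingleton ℝ (cellIndicator D hh m))
  exact h

/-- As `φ` vanishes off `D`, cells that cross the boundary of `D` may be integrated over in full. -/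
theorem inner_cellIndicator (hφ : IsTestFunction D φ) {h : ℝ} (hh : 0 < h)
    {f : L2 D} (hf : f =ᵐ[volume.restrict D] φ) (m : Fin d → ℤ) :
    inner ℝ (cellIndicator D hh m) f = ∫ y in gridCell h m, φ y := by
  rw [cellIndicator, L2.inner_indicatorConstLp_one]
  calc ∫ x in gridCell h m, f x ∂(volume.restrict D)
      = ∫ x in gridCell h m, φ x ∂(volume.restrict D) :=
        integral_congr_ae (ae_restrict_of_ae hf)
    _ = ∫ y in gridCell h m, φ y := by
        rw [Measure.restrict_restrict (measurableSet_gridCell h m)]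
        exact (setIntegral_eq_of_subset_of_forall_sdiff_eq_zero (measurableSet_gridCell h m)
          inter_subset_left fun x hx => hφ.eq_zero fun hxD => hx.2 ⟨hx.1, hxD⟩).symm

theorem cellAverage_coeFn (hφ : IsTestFunction D φ) (hD : IsOpen D) {h : ℝ} (hh : 0 < h)
    {F : Finset (Fin d → ℤ)} (hF : gridIndex h '' D ⊆ F)
    {f : L2 D} (hf : f =ᵐ[volume.restrict D] φ) :
    ∀ᵐ x ∂(volume.restrict D),
      cellAverage D hh F f x = (h ^ d)⁻¹ * ∫ y in gridCell h (gridIndex h x), φ y := by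
  have hG : cellAverage D hh F f =
      ∑ m ∈ F, ((h ^ d)⁻¹ * ∫ y in gridCell h m, φ y) • cellIndicator D hh m := by
    rw [cellAverage, _root_.sum_apply]
    refine Finset.sum_congr rfl fun m _ => ?_
    rw [_root_.smul_apply, ContinuousLinearMap.smulRight_apply, innerSL_apply_apply,
      inner_cellIndicator hφ hh hf, smul_smul]
  rw [hG]
  have h1 := Lp.coeFn_finsetSum F
    (fun m => ((h ^ d)⁻¹ * ∫ y in gridCell h m, φ y) • cellIndicator D hh m)
  have h2 : ∀ᵐ x ∂(volume.restrict D), ∀ m : Fin d → ℤ,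
      (((h ^ d)⁻¹ * ∫ y in gridCell h m, φ y) • cellIndicator D hh m : L2 D) x =
        ((h ^ d)⁻¹ * ∫ y in gridCell h m, φ y) * (gridCell h m).indicator (fun _ => (1 : ℝ)) x := by
    rw [ae_all_iff]
    intro m
    filter_upwards [Lp.coeFn_smul ((h ^ d)⁻¹ * ∫ y in gridCell h m, φ y) (cellIndicator D hh m),
      indicatorConstLp_coeFn (p := 2) (hs := measurableSet_gridCell h m)
        (hμs := volume_restrict_gridCell_ne_top (D := D) hh m) (c := (1 : ℝ))] with x hx1 hx2
    rw [hx1, Pi.smul_apply, smul_eq_mul, cellIndicator, hx2]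
  filter_upwards [h1, h2, ae_restrict_mem hD.measurableSet] with x hx1 hx2 hxD
  rw [hx1, Finset.sum_apply, Finset.sum_eq_single (gridIndex h x)]
  · rw [hx2, indicator_of_mem (mem_gridCell.2 rfl), mul_one]
  · intro m _ hm
    rw [hx2, indicator_of_notMem (fun hmem => hm (mem_gridCell.1 hmem).symm), mul_zero]
  · intro hn
    exact absurd (hF ⟨x, hxD, rfl⟩) hn

/-- Cauchy–Schwarz on the cell of `x`, which lies in the ball of radius `h√d` about `x`. After the
substitution `y = x + z` the domain of integration no longer depends on `x`. -/
theorem enorm_sub_average_sq_le (hφ : Continuous φ) (hφi : Integrable φ) {h : ℝ} (hh : 0 < h)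
    (x : Space d) :
    ‖φ x - (h ^ d)⁻¹ * ∫ y in gridCell h (gridIndex h x), φ y‖ₑ ^ 2 ≤
      (ENNReal.ofReal h ^ d)⁻¹ *
        ∫⁻ z in Metric.closedBall 0 (h * √d), ‖φ (x + z) - φ x‖ₑ ^ 2 := by
  set Q := gridCell h (gridIndex h x) with hQ
  have hvol : volume Q = ENNReal.ofReal h ^ d := volume_gridCell hh _
  have hv0 : ENNReal.ofReal h ^ d ≠ 0 := pow_ne_zero _ (by simpa using hh)
  have hvt : ENNReal.ofReal h ^ d ≠ ⊤ := ENNReal.pow_ne_top ENNReal.ofReal_ne_top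
  have hreal : volume.real Q = h ^ d := by
    rw [Measure.real, hvol, ENNReal.toReal_pow, ENNReal.toReal_ofReal hh.le]
  have e1 : φ x - (h ^ d)⁻¹ * ∫ y in Q, φ y = (h ^ d)⁻¹ * ∫ y in Q, (φ x - φ y) := by
    have hc : IntegrableOn (fun _ : Space d => φ x) Q :=
      integrableOn_const (by rw [hvol]; exact hvt)
    rw [integral_sub hc hφi.integrableOn,
      setIntegral_const, hreal, smul_eq_mul, mul_sub, inv_mul_cancel_left₀ (by positivity)]
  have e2 : ‖(h ^ d)⁻¹‖ₑ = (ENNReal.ofReal h ^ d)⁻¹ := by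
    rw [enorm_inv (by positivity), enorm_pow, Real.enorm_of_nonneg hh.le]
  have hm : Measurable fun y => ‖φ x - φ y‖ₑ := by
    have := hφ.measurable
    fun_prop
  rw [e1, enorm_mul, e2, mul_pow]
  calc ((ENNReal.ofReal h ^ d)⁻¹) ^ 2 * ‖∫ y in Q, (φ x - φ y)‖ₑ ^ 2
      ≤ ((ENNReal.ofReal h ^ d)⁻¹) ^ 2 *
          (ENNReal.ofReal h ^ d * ∫⁻ y in Q, ‖φ x - φ y‖ₑ ^ 2) := by
        gcongr
        refine (pow_le_pow_left₀ zero_le (enorm_integral_le_lintegral_enorm _) 2).trans ?_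
        refine (sq_lintegral_le _ hm.aemeasurable).trans ?_
        rw [Measure.restrict_apply_univ, hvol]
    _ = (ENNReal.ofReal h ^ d)⁻¹ * ∫⁻ y in Q, ‖φ x - φ y‖ₑ ^ 2 := by
        rw [sq, mul_assoc, ← mul_assoc _ (ENNReal.ofReal h ^ d), ENNReal.inv_mul_cancel hv0 hvt,
          one_mul]
    _ ≤ (ENNReal.ofReal h ^ d)⁻¹ *
          ∫⁻ z in Metric.closedBall 0 (h * √d), ‖φ (x + z) - φ x‖ₑ ^ 2 := by
        refine mul_le_mul_right ?_ _
        rw [← lintegral_indicator (measurableSet_gridCell h _),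
          ← lintegral_indicator Metric.isClosed_closedBall.measurableSet,
          ← lintegral_add_left_eq_self _ x]
        refine lintegral_mono fun z => ?_
        refine indicator_apply_le' (fun hz => ?_) fun _ => zero_le
        have hzb : z ∈ Metric.closedBall (0 : Space d) (h * √d) := by
          have := norm_sub_le_of_mem_gridCell hh (mem_gridCell.2 rfl) hz
          simpa using this
        rw [indicator_of_mem hzb, enorm_sub_rev]

/-- The ball has volume proportional to `h ^ d`, which cancels the averaging factor; what is left is
of order `h²`. -/
theorem lintegral_sub_average_sq_le (hφ : IsTestFunction D φ) {h : ℝ} (hh : 0 < h) :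
    ∫⁻ x in D, ‖φ x - (h ^ d)⁻¹ * ∫ y in gridCell h (gridIndex h x), φ y‖ₑ ^ 2 ≤
      ENNReal.ofReal (√d ^ d) * volume (Metric.ball (0 : Space d) 1) *
        (ENNReal.ofReal (h * √d) ^ 2 * ∫⁻ x, ‖∇ φ x‖ₑ ^ 2) := by
  have hφi : Integrable φ := hφ.1.continuous.integrable_of_hasCompactSupport hφ.2.1
  have hv0 : ENNReal.ofReal h ^ d ≠ 0 := pow_ne_zero _ (by simpa using hh)
  have hvt : ENNReal.ofReal h ^ d ≠ ⊤ := ENNReal.pow_ne_top ENNReal.ofReal_ne_top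
  have hm : Measurable fun q : Space d × Space d => ‖φ (q.1 + q.2) - φ q.1‖ₑ ^ 2 := by
    have := hφ.1.continuous.measurable
    fun_prop
  calc ∫⁻ x in D, ‖φ x - (h ^ d)⁻¹ * ∫ y in gridCell h (gridIndex h x), φ y‖ₑ ^ 2
      ≤ ∫⁻ x, ‖φ x - (h ^ d)⁻¹ * ∫ y in gridCell h (gridIndex h x), φ y‖ₑ ^ 2 :=
        setLIntegral_le_lintegral _ _
    _ ≤ ∫⁻ x, (ENNReal.ofReal h ^ d)⁻¹ *
          ∫⁻ z in Metric.closedBall 0 (h * √d), ‖φ (x + z) - φ x‖ₑ ^ 2 :=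
        lintegral_mono fun x => enorm_sub_average_sq_le hφ.1.continuous hφi hh x
    _ = (ENNReal.ofReal h ^ d)⁻¹ *
          ∫⁻ x, ∫⁻ z in Metric.closedBall 0 (h * √d), ‖φ (x + z) - φ x‖ₑ ^ 2 :=
        lintegral_const_mul _ hm.lintegral_prod_right
    _ = (ENNReal.ofReal h ^ d)⁻¹ *
          ∫⁻ z in Metric.closedBall 0 (h * √d), ∫⁻ x, ‖φ (x + z) - φ x‖ₑ ^ 2 := by
        rw [lintegral_lintegral_swap hm.aemeasurable]
    _ ≤ (ENNReal.ofReal h ^ d)⁻¹ *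
          ∫⁻ _z in Metric.closedBall (0 : Space d) (h * √d),
            ENNReal.ofReal (h * √d) ^ 2 * ∫⁻ x, ‖∇ φ x‖ₑ ^ 2 := by
        refine mul_le_mul_right ?_ _
        refine setLIntegral_mono measurable_const fun z hz => ?_
        refine (lintegral_translate_sub_sq_le hφ.1 z).trans ?_
        gcongr
        rw [← ofReal_norm]
        exact ENNReal.ofReal_le_ofReal (by simpa using hz)
    _ = _ := by
        rw [setLIntegral_const, Measure.addHaar_closedBall _ _ (by positivity),
          finrank_euclideanSpace_fin, mul_pow h (√d) d,
          ENNReal.ofReal_mul (p := h ^ d) (by positivity), ENNReal.ofReal_pow hh.le]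
        rw [mul_comm (_ * ∫⁻ x, ‖∇ φ x‖ₑ ^ 2), mul_assoc (ENNReal.ofReal h ^ d),
          mul_assoc (ENNReal.ofReal h ^ d), ← mul_assoc, ENNReal.inv_mul_cancel hv0 hvt, one_mul]

/-- A linear estimate on `H¹₀(D)` may be checked on test functions. -/
theorem norm_le_of_forall_isTestFunction {E : Type*} [NormedAddCommGroup E] [NormedSpace ℝ E]
    (T : L2 D →L[ℝ] E) (C : ℝ)
    (hT : ∀ (φ : Space d → ℝ) (f : L2 D) (g : L2Vec D), IsTestFunction D φ →
      f =ᵐ[volume.restrict D] φ → g =ᵐ[volume.restrict D] ∇ φ → ‖T f‖ ≤ C * ‖g‖) (u : H10 D) :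
    ‖T (fn u)‖ ≤ C * ‖grad u‖ := by
  have hcl : IsClosed {p : H1Ambient D | ‖T p.fst‖ ≤ C * ‖p.snd‖} := by
    refine isClosed_le ?_ ?_
    · exact (T.continuous.comp (WithLp.prod_continuous_ofLp 2 _ _).fst).norm
    · exact continuous_const.mul (WithLp.prod_continuous_ofLp 2 _ _).snd.norm
  have hsub : (testGraph D : Set (H1Ambient D)) ⊆ {p | ‖T p.fst‖ ≤ C * ‖p.snd‖} := by
    rintro p ⟨φ, hφ, h1, h2⟩
    exact hT φ _ _ hφ h1 h2
  exact closure_minimal hsub hcl u.2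

/-- The inclusion of `H¹₀(D)` in `L²(D)`. -/
def inclusion (D : Set (Space d)) : H10 D →L[ℝ] L2 D :=
  (WithLp.fstL 2 ℝ (L2 D) (L2Vec D)).comp (H10 D).subtypeL

theorem norm_sq_eq (u : H10 D) : ‖u‖ ^ 2 = ‖fn u‖ ^ 2 + ‖grad u‖ ^ 2 :=
  WithLp.prod_norm_sq_eq_of_L2 (u : H1Ambient D)

theorem norm_grad_le (u : H10 D) : ‖grad u‖ ≤ ‖u‖ := by
  refine abs_le_of_sq_le_sq' ?_ (norm_nonneg _) |>.2
  rw [norm_sq_eq]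
  nlinarith [sq_nonneg ‖fn u‖]

theorem norm_le_of_enorm_sq_le {E F : Type*} [NormedAddCommGroup E] [NormedAddCommGroup F]
    {x : E} {y : F} {C : ℝ} (hC : 0 ≤ C) (h : ‖x‖ₑ ^ 2 ≤ ENNReal.ofReal C ^ 2 * ‖y‖ₑ ^ 2) :
    ‖x‖ ≤ C * ‖y‖ := by
  rw [← mul_pow, ENNReal.pow_le_pow_left_iff (by norm_num), ← ofReal_norm, ← ofReal_norm,
    ← ENNReal.ofReal_mul hC] at h
  exact (ENNReal.ofReal_le_ofReal_iff (by positivity)).1 h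

/-- The **Poincaré inequality** on `H¹₀(D)`. -/
theorem exists_norm_fn_le (hd : 1 ≤ d) (hDo : IsOpen D) (hDb : Bornology.IsBounded D) :
    ∃ C : ℝ, 0 ≤ C ∧ ∀ u : H10 D, ‖fn u‖ ≤ C * ‖grad u‖ := by
  obtain ⟨C, hC⟩ := exists_poincare_const hd hDb
  refine ⟨C, C.2, norm_le_of_forall_isTestFunction (ContinuousLinearMap.id ℝ _) C ?_⟩
  intro φ f g hφ hf hg
  refine norm_le_of_enorm_sq_le C.2 ?_
  rw [hφ.enorm_grad_sq hDo hg, ENNReal.ofReal_coe_nnreal]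
  refine le_trans (le_of_eq ?_) (hC φ hφ)
  rw [ContinuousLinearMap.id_apply, enorm_sq_eq_lintegral]
  refine lintegral_congr_ae ?_
  filter_upwards [hf] with x hx
  rw [hx]

/-- The **Rellich theorem**: for bounded `D` the inclusion of `H¹₀(D)` in `L²(D)` is compact. -/
theorem isCompactOperator_inclusion (hDo : IsOpen D) (hDb : Bornology.IsBounded D) :
    IsCompactOperator (inclusion D) := by
  set K : ℝ := √(√d ^ d * (volume (Metric.ball (0 : Space d) 1)).toReal) * √d with hK
  have hK0 : 0 ≤ K := by positivity
  have hpos : ∀ n : ℕ, (0 : ℝ) < 1 / ((n : ℝ) + 1) := fun n => by positivity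
  let F : ℕ → Finset (Fin d → ℤ) := fun n => (finite_gridIndex_image (hpos n) hDb).toFinset
  let G : ℕ → L2 D →L[ℝ] L2 D := fun n => cellAverage D (hpos n) (F n)
  have hest : ∀ n (u : H10 D), ‖fn u - G n (fn u)‖ ≤ K * (1 / ((n : ℝ) + 1)) * ‖grad u‖ := by
    intro n u
    refine norm_le_of_forall_isTestFunction (ContinuousLinearMap.id ℝ _ - G n) _ ?_ u
    intro φ f g hφ hf hg
    refine norm_le_of_enorm_sq_le (mul_nonneg hK0 (hpos n).le) ?_
    rw [hφ.enorm_grad_sq hDo hg, enorm_sq_eq_lintegral]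
    have h1 := lintegral_sub_average_sq_le hφ (hpos n)
    have h2 : ∫⁻ x in D, ‖((ContinuousLinearMap.id ℝ (L2 D) - G n) f : L2 D) x‖ₑ ^ 2 =
        ∫⁻ x in D, ‖φ x - ((1 / ((n : ℝ) + 1)) ^ d)⁻¹ *
          ∫ y in gridCell (1 / ((n : ℝ) + 1)) (gridIndex (1 / ((n : ℝ) + 1)) x), φ y‖ₑ ^ 2 := by
      refine lintegral_congr_ae ?_
      have h3 := cellAverage_coeFn hφ hDo (hpos n) (F := F n) (by simp [F]) hf
      filter_upwards [hf, h3, Lp.coeFn_sub f (G n f)] with x hx1 hx2 hx3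
      rw [_root_.sub_apply, ContinuousLinearMap.id_apply, hx3, Pi.sub_apply, hx1, hx2]
    rw [h2]
    refine h1.trans (le_of_eq ?_)
    have hvol : volume (Metric.ball (0 : Space d) 1) ≠ ⊤ := measure_ball_lt_top.ne
    rw [← mul_assoc]
    congr 1
    rw [← ENNReal.ofReal_toReal hvol, ← ENNReal.ofReal_mul (by positivity),
      ← ENNReal.ofReal_pow (by positivity), ← ENNReal.ofReal_pow (by positivity),
      ← ENNReal.ofReal_mul (by positivity), hK]
    congr 1
    rw [mul_pow, mul_pow, mul_pow,
      Real.sq_sqrt (x := √d ^ d * (volume (Metric.ball (0 : Space d) 1)).toReal) (by positivity)]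
    ring
  have hnorm : ∀ n, ‖(G n).comp (inclusion D) - inclusion D‖ ≤ K * (1 / ((n : ℝ) + 1)) := by
    intro n
    refine ContinuousLinearMap.opNorm_le_bound _ (mul_nonneg hK0 (hpos n).le) fun u => ?_
    rw [_root_.sub_apply, norm_sub_rev]
    refine (hest n u).trans ?_
    exact mul_le_mul_of_nonneg_left (norm_grad_le u) (mul_nonneg hK0 (hpos n).le)
  have hlim : Filter.Tendsto (fun n => (G n).comp (inclusion D)) Filter.atTop
      (nhds (inclusion D)) := by
    refine (tendsto_iff_norm_sub_tendsto_zero (E := H10 D →L[ℝ] L2 D)).2 ?_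
    refine squeeze_zero (fun n => norm_nonneg ((G n).comp (inclusion D) - inclusion D)) hnorm ?_
    simpa using (tendsto_one_div_add_atTop_nhds_zero_nat (𝕜 := ℝ)).const_mul K
  -- The inclusion is a limit in operator norm of finite rank operators.
  exact isCompactOperator_of_tendsto hlim
    (Filter.Eventually.of_forall fun n => (isCompactOperator_cellAverage _ _).comp_clm _)

end Rellich

/-! ### The forms on `H¹₀(D)` and comparison of their eigenvalues -/

section EnergyForms

variable {d : ℕ} {D : Set (Space d)} {φ : Space d → ℝ}

instance (D : Set (Space d)) : CompleteSpace (H10 D) :=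
  (testGraph D).isClosed_topologicalClosure.completeSpace_coe

theorem IsTestFunction.exists_fn_ae_eq (hφ : IsTestFunction D φ) :
    ∃ u : H10 D, fn u =ᵐ[volume.restrict D] φ := by
  have h1 : MemLp φ 2 (volume.restrict D) :=
    (hφ.1.continuous.memLp_of_hasCompactSupport hφ.2.1).restrict D
  have hsupp : HasCompactSupport (∇ φ) :=
    (hφ.2.1.fderiv (𝕜 := ℝ)).comp_left (map_zero _)
  have h2 : MemLp (∇ φ) 2 (volume.restrict D) :=
    ((continuous_gradient hφ.1).memLp_of_hasCompactSupport hsupp).restrict D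
  refine ⟨⟨WithLp.toLp 2 (h1.toLp φ, h2.toLp (∇ φ)), ?_⟩, h1.coeFn_toLp⟩
  exact (testGraph D).le_topologicalClosure ⟨φ, hφ, h1.coeFn_toLp, h2.coeFn_toLp⟩

/-- `H¹₀(D)` has infinite dimension, already as a subspace of `L²(D)`. -/
theorem not_finiteDimensional_range_inclusion (hd : 1 ≤ d) (hDo : IsOpen D) (hDn : D.Nonempty) :
    ¬ FiniteDimensional ℝ (LinearMap.range (inclusion D).toLinearMap) := by
  intro hfin
  set n := Module.finrank ℝ (LinearMap.range (inclusion D).toLinearMap)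
  have : Nonempty (Fin d) := ⟨⟨0, hd⟩⟩
  obtain ⟨x₀, hx₀⟩ := hDn
  have hinf : D.Infinite := infinite_of_mem_nhds x₀ (hDo.mem_nhds hx₀)
  -- Bump functions at `n + 1` points of `D`, each vanishing at the other points, give too many
  -- independent elements.
  obtain ⟨s, hsD, hcard⟩ := hinf.exists_subset_card_eq (n + 1)
  have hbump : ∀ x : s, ∃ ψ : Space d → ℝ, IsTestFunction D ψ ∧ ψ x = 1 ∧
      ∀ y ∈ s, y ≠ x → ψ y = 0 := by
    intro x
    have hnhds : D \ ((s.erase (x : Space d) : Finset (Space d)) : Set (Space d)) ∈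
        nhds (x : Space d) :=
      (hDo.sdiff (Finset.finite_toSet _).isClosed).mem_nhds ⟨hsD x.2, by simp⟩
    obtain ⟨ψ, h1, h2, h3, -, h5⟩ := exists_contDiff_tsupport_subset (n := ⊤) hnhds
    refine ⟨ψ, ⟨h3, h2, h1.trans sdiff_subset⟩, h5, fun y hy hyx => ?_⟩
    exact image_eq_zero_of_notMem_tsupport fun hmem =>
      (h1 hmem).2 (by simpa using ⟨hy, hyx⟩)
  choose ψ hψ hψ1 hψ0 using hbump
  choose u hu using fun x => (hψ x).exists_fn_ae_eq
  let f : s → LinearMap.range (inclusion D).toLinearMap := fun x => ⟨fn (u x), u x, rfl⟩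
  have hli : LinearIndependent ℝ f := by
    rw [Fintype.linearIndependent_iff]
    intro c hc x
    have h0 : ∑ x, c x • fn (u x) = 0 := by
      simpa [f] using congrArg Subtype.val hc
    have h1 : (fun y => ∑ x, c x * ψ x y) =ᵐ[volume.restrict D] fun _ => (0 : ℝ) := by
      have h2 := Lp.coeFn_finsetSum Finset.univ (fun x => c x • fn (u x))
      have h3 : ∀ᵐ y ∂(volume.restrict D), ∀ x, (c x • fn (u x) : L2 D) y = c x * ψ x y := by
        rw [ae_all_iff]
        intro x
        filter_upwards [Lp.coeFn_smul (c x) (fn (u x)), hu x] with y hy1 hy2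
        rw [hy1, Pi.smul_apply, hy2, smul_eq_mul]
      have h4 := Lp.coeFn_zero ℝ 2 (volume.restrict D)
      rw [h0] at h2
      filter_upwards [h2, h3, h4] with y hy2 hy3 hy4
      rw [hy4, Finset.sum_apply] at hy2
      rw [← Finset.sum_congr rfl fun x _ => hy3 x, ← hy2]
      rfl
    -- Continuous functions equal almost everywhere on an open set agree on it, so the relation can
    -- be evaluated at the point `x`.
    have h2 := Measure.eqOn_open_of_ae_eq h1 hDo
      (continuous_finsetSum _ fun x _ => continuous_const.mul
        (hψ x).1.continuous).continuousOn continuousOn_const (hsD x.2)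
    change ∑ y, c y * ψ y x = 0 at h2
    rw [Finset.sum_eq_single x] at h2
    · simpa [hψ1] using h2
    · intro y _ hyx
      rw [hψ0 y x x.2 fun h => hyx (Subtype.ext h.symm), mul_zero]
    · simp
  have := hli.fintype_card_le_finrank
  rw [Fintype.card_coe, hcard] at this
  omega

/-- With `ι` the inclusion, the abstract definitions unfold to the concrete ones. -/
theorem eigenvalue_eq_weakEigenvalue (B : LinearMap.BilinForm ℝ (H10 D)) :
    eigenvalue B = weakEigenvalue (inclusion D) B := rfl

theorem eigenspace_eq_weakEigenspace (B : LinearMap.BilinForm ℝ (H10 D)) (t : ℝ) :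
    eigenspace B t = weakEigenspace (inclusion D) B t := rfl

theorem isOrderedEigenvalues_eigenvalue (hd : 1 ≤ d) (hDo : IsOpen D)
    (hDb : Bornology.IsBounded D) (hDn : D.Nonempty) {B : LinearMap.BilinForm ℝ (H10 D)}
    (hB : IsEnergyForm B) : IsOrderedEigenvalues B (eigenvalue B) := by
  have hι := isCompactOperator_inclusion hDo hDb
  have hinf := not_finiteDimensional_range_inclusion hd hDo hDn
  rw [eigenvalue_eq_weakEigenvalue]
  refine ⟨weakEigenvalue_pos hB hι hinf le_rfl,
    fun k hk => weakEigenvalue_mono hB hι hinf hk k.le_succ, fun t => ?_⟩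
  rw [eigenspace_eq_weakEigenspace]
  exact encard_weakEigenvalue_eq hB hι hinf t

theorem isEnergyForm_of_bounds (hd : 1 ≤ d) (hDo : IsOpen D) (hDb : Bornology.IsBounded D)
    {B : LinearMap.BilinForm ℝ (H10 D)} (hsymm : ∀ u v, B u v = B v u) {c C : ℝ} (hc : 0 < c)
    (hC : 0 ≤ C) (hlow : ∀ u, c * ‖grad u‖ ^ 2 ≤ B u u) (hup : ∀ u, B u u ≤ C * ‖grad u‖ ^ 2) :
    IsEnergyForm B where
  symm := hsymm
  bounded := ⟨C, hC, fun u => (hup u).trans <| by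
    have := norm_grad_le u
    gcongr⟩
  coercive := by
    obtain ⟨K, hK, hP⟩ := exists_norm_fn_le hd hDo hDb
    -- Poincaré's inequality gives `‖u‖² ≤ (K² + 1)‖∇u‖²`.
    refine ⟨c / (K ^ 2 + 1), by positivity, fun u => ?_⟩
    refine le_trans ?_ (hlow u)
    rw [div_mul_eq_mul_div, div_le_iff₀ (by positivity), mul_assoc]
    refine mul_le_mul_of_nonneg_left ?_ hc.le
    have h1 : ‖fn u‖ ^ 2 ≤ (K * ‖grad u‖) ^ 2 := pow_le_pow_left₀ (norm_nonneg _) (hP u) 2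
    rw [norm_sq_eq]
    nlinarith

theorem dirichletForm_self (u : H10 D) : dirichletForm D u u = ‖grad u‖ ^ 2 :=
  real_inner_self_eq_norm_sq (grad u)

theorem isEnergyForm_dirichletForm (hd : 1 ≤ d) (hDo : IsOpen D) (hDb : Bornology.IsBounded D) :
    IsEnergyForm (dirichletForm D) :=
  isEnergyForm_of_bounds hd hDo hDb (fun u v => real_inner_comm (grad v) (grad u)) one_pos
    zero_le_one (fun u => by rw [dirichletForm_self, one_mul])
    (fun u => by rw [dirichletForm_self, one_mul])

theorem integral_inner_grad_self (u : H10 D) :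
    ∫ x in D, inner ℝ (grad u x) (grad u x) = ‖grad u‖ ^ 2 := dirichletForm_self u

theorem diffusionForm_apply (a : Linf D) (u v : H10 D) :
    diffusionForm a u v = ∫ x in D, a x * inner ℝ (grad u x) (grad v x) := rfl

theorem diffusionForm_symm (a : Linf D) (u v : H10 D) :
    diffusionForm a u v = diffusionForm a v u := by
  simp_rw [diffusionForm_apply, real_inner_comm]

theorem diffusionForm_self_le {a : Linf D} {C : ℝ} (ha : ∀ᵐ x ∂(volume.restrict D), a x ≤ C)
    (u : H10 D) : diffusionForm a u u ≤ C * ‖grad u‖ ^ 2 := by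
  rw [diffusionForm_apply, ← integral_inner_grad_self, ← integral_const_mul]
  refine integral_mono_ae (integrable_coeff_mul_inner a _ _)
    ((L2.integrable_inner (𝕜 := ℝ) _ _).const_mul C) ?_
  filter_upwards [ha] with x hx
  exact mul_le_mul_of_nonneg_right hx real_inner_self_nonneg

theorem le_diffusionForm_self {a : Linf D} {c : ℝ} (ha : ∀ᵐ x ∂(volume.restrict D), c ≤ a x)
    (u : H10 D) : c * ‖grad u‖ ^ 2 ≤ diffusionForm a u u := by
  rw [diffusionForm_apply, ← integral_inner_grad_self, ← integral_const_mul]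
  refine integral_mono_ae ((L2.integrable_inner (𝕜 := ℝ) _ _).const_mul c)
    (integrable_coeff_mul_inner a _ _) ?_
  filter_upwards [ha] with x hx
  exact mul_le_mul_of_nonneg_right hx real_inner_self_nonneg

theorem ae_abs_le_norm (a : Linf D) : ∀ᵐ x ∂(volume.restrict D), |a x| ≤ ‖a‖ := by
  filter_upwards [ae_le_eLpNormEssSup (f := a) (μ := volume.restrict D)] with x hx
  rw [Lp.norm_def, eLpNorm_exponent_top]
  have h2 : eLpNormEssSup a (volume.restrict D) ≠ ⊤ := by
    rw [← eLpNorm_exponent_top]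
    exact Lp.eLpNorm_ne_top a
  simpa using ENNReal.toReal_mono h2 hx

theorem diffusionForm_self_le_add (a b : Linf D) (u : H10 D) :
    diffusionForm a u u ≤ diffusionForm b u u + ‖a - b‖ * ‖grad u‖ ^ 2 := by
  rw [diffusionForm_apply, diffusionForm_apply, ← integral_inner_grad_self, ← integral_const_mul,
    ← integral_add (integrable_coeff_mul_inner b _ _)
      ((L2.integrable_inner (𝕜 := ℝ) _ _).const_mul _)]
  refine integral_mono_ae (integrable_coeff_mul_inner a _ _)
    ((integrable_coeff_mul_inner b _ _).add ((L2.integrable_inner (𝕜 := ℝ) _ _).const_mul _)) ?_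
  filter_upwards [ae_abs_le_norm (a - b), Lp.coeFn_sub a b] with x hx1 hx2
  rw [hx2, Pi.sub_apply] at hx1
  rw [← add_mul]
  exact mul_le_mul_of_nonneg_right (by linarith [le_abs_self (a x - b x)]) real_inner_self_nonneg

theorem isEnergyForm_diffusionForm (hd : 1 ≤ d) (hDo : IsOpen D) (hDb : Bornology.IsBounded D)
    {a : Linf D} {c C : ℝ} (hc : 0 < c) (hcC : c ≤ C)
    (ha : ∀ᵐ x ∂(volume.restrict D), c ≤ a x ∧ a x ≤ C) : IsEnergyForm (diffusionForm a) :=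
  isEnergyForm_of_bounds hd hDo hDb (diffusionForm_symm a) hc (hc.le.trans hcC)
    (le_diffusionForm_self (ha.mono fun _ h => h.1))
    (diffusionForm_self_le (ha.mono fun _ h => h.2))

/-- One-sided Lipschitz dependence of the eigenvalues on the coefficient. -/
theorem eigenvalue_diffusionForm_sub_le (hd : 1 ≤ d) (hDo : IsOpen D)
    (hDb : Bornology.IsBounded D) (hDn : D.Nonempty) {a b : Linf D} {c C : ℝ} (hc : 0 < c)
    (hcC : c ≤ C) (ha : ∀ᵐ x ∂(volume.restrict D), c ≤ a x ∧ a x ≤ C)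
    (hb : ∀ᵐ x ∂(volume.restrict D), c ≤ b x ∧ b x ≤ C) {k : ℕ} (hk : 1 ≤ k) :
    eigenvalue (diffusionForm a) k - eigenvalue (diffusionForm b) k ≤
      C * chi D k / c * ‖a - b‖ := by
  have hA := isEnergyForm_diffusionForm hd hDo hDb hc hcC ha
  have hB := isEnergyForm_diffusionForm hd hDo hDb hc hcC hb
  have hι := isCompactOperator_inclusion hDo hDb
  have hinf := not_finiteDimensional_range_inclusion hd hDo hDn
  -- Ellipticity of `b` turns the additive perturbation into a multiplicative one, as form
  -- comparison requires.
  have h1 : eigenvalue (diffusionForm a) k ≤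
      (1 + ‖a - b‖ / c) * eigenvalue (diffusionForm b) k := by
    refine weakEigenvalue_le_mul hA hB hι hinf hk (by positivity) fun u => ?_
    refine (diffusionForm_self_le_add a b u).trans ?_
    rw [add_mul, one_mul, div_mul_eq_mul_div, mul_div_assoc]
    refine add_le_add_right (mul_le_mul_of_nonneg_left ?_ (norm_nonneg _)) _
    rw [le_div_iff₀ hc, mul_comm]
    exact le_diffusionForm_self (hb.mono fun _ h => h.1) u
  have h2 : eigenvalue (diffusionForm b) k ≤ C * chi D k := by
    refine weakEigenvalue_le_mul hB (isEnergyForm_dirichletForm hd hDo hDb) hι hinf hk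
      (hc.le.trans hcC) fun u => ?_
    rw [dirichletForm_self]
    exact diffusionForm_self_le (hb.mono fun _ h => h.2) u
  calc eigenvalue (diffusionForm a) k - eigenvalue (diffusionForm b) k
      ≤ ‖a - b‖ / c * eigenvalue (diffusionForm b) k := by linarith
    _ ≤ ‖a - b‖ / c * (C * chi D k) := mul_le_mul_of_nonneg_left h2 (by positivity)
    _ = C * chi D k / c * ‖a - b‖ := by ring

/-- The one-sided bound is used in both directions; its constant is then enlarged by the factor `C
χ_k / (c χ_1) ≥ 1`. -/
theorem abs_eigenvalue_diffusionForm_sub_le (hd : 1 ≤ d) (hDo : IsOpen D)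
    (hDb : Bornology.IsBounded D) (hDn : D.Nonempty) {a b : Linf D} {c C : ℝ} (hc : 0 < c)
    (hcC : c ≤ C) (ha : ∀ᵐ x ∂(volume.restrict D), c ≤ a x ∧ a x ≤ C)
    (hb : ∀ᵐ x ∂(volume.restrict D), c ≤ b x ∧ b x ≤ C) {k : ℕ} (hk : 1 ≤ k) :
    |eigenvalue (diffusionForm a) k - eigenvalue (diffusionForm b) k| ≤
      C ^ 2 * chi D k ^ 2 / (c ^ 2 * chi D 1) * ‖a - b‖ := by
  have hE := isEnergyForm_dirichletForm hd hDo hDb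
  have hι := isCompactOperator_inclusion hDo hDb
  have hinf := not_finiteDimensional_range_inclusion hd hDo hDn
  have hpos : 0 < chi D 1 := weakEigenvalue_pos hE hι hinf le_rfl
  have hmono : chi D 1 ≤ chi D k := weakEigenvalue_mono hE hι hinf le_rfl hk
  have hab := eigenvalue_diffusionForm_sub_le hd hDo hDb hDn hc hcC ha hb hk
  have hba := eigenvalue_diffusionForm_sub_le hd hDo hDb hDn hc hcC hb ha hk
  rw [norm_sub_rev] at hba
  have hconst : C * chi D k / c ≤ C ^ 2 * chi D k ^ 2 / (c ^ 2 * chi D 1) := by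
    have hCk : 0 < C * chi D k := mul_pos (hc.trans_le hcC) (hpos.trans_le hmono)
    have hle : c * chi D 1 ≤ C * chi D k := mul_le_mul hcC hmono hpos.le (hc.le.trans hcC)
    rw [div_le_div_iff₀ hc (by positivity)]
    have := mul_le_mul_of_nonneg_left hle (mul_pos hCk hc).le
    nlinarith
  exact (abs_sub_le_iff.2 ⟨hab, hba⟩).trans
    (mul_le_mul_of_nonneg_right hconst (norm_nonneg _))

end EnergyForms

/-! ### Summability and the affine coefficient -/

section Coefficients

variable {d : ℕ} {D : Set (Space d)}

/-- The terms are eventually at most 1, and there `f j ≤ f j ^ p`. -/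
theorem summable_of_summable_rpow {f : ℕ → ℝ} (hf : ∀ j, 0 ≤ f j) {p : ℝ} (hp : 0 < p)
    (hp1 : p ≤ 1) (h : Summable fun j => f j ^ p) : Summable f := by
  refine h.of_norm_bounded_eventually_nat ?_
  filter_upwards [h.tendsto_atTop_zero.eventually (ge_mem_nhds one_pos)] with j hj
  have h1 : f j ≤ 1 := by
    by_contra hgt
    exact absurd hj (not_le.2 (Real.one_lt_rpow (not_le.1 hgt) hp))
  rw [Real.norm_of_nonneg (hf j)]
  calc f j = f j ^ (1 : ℝ) := (Real.rpow_one _).symm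
    _ ≤ f j ^ p := Real.rpow_le_rpow_of_exponent_ge' (hf j) h1 hp.le hp1

theorem norm_coeff_sub_le {a : ℕ → Linf D} (ha : Summable fun j : ℕ => ‖a (j + 1)‖)
    (y y' : SeqInf) : ‖coeff a y - coeff a y'‖ ≤ (∑' j : ℕ, ‖a (j + 1)‖) * ‖y - y'‖ := by
  have hs : ∀ z : SeqInf, Summable fun j : ℕ => z j • a (j + 1) := fun z => by
    refine Summable.of_norm_bounded (ha.mul_left ‖z‖) fun j => ?_
    rw [norm_smul]
    exact mul_le_mul_of_nonneg_right (lp.norm_apply_le_norm ENNReal.top_ne_zero z j)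
      (norm_nonneg _)
  rw [coeff, coeff, add_sub_add_left_eq_sub, ← (hs y).tsum_sub (hs y'), ← tsum_mul_right]
  refine tsum_of_norm_bounded (ha.mul_right _).hasSum fun j => ?_
  rw [← sub_smul, norm_smul, mul_comm]
  exact mul_le_mul_of_nonneg_left (lp.norm_apply_le_norm ENNReal.top_ne_zero (y - y') j)
    (norm_nonneg _)

end Coefficients

end EllipticEVP

end

/-! ### Ordered eigenvalues and the Lipschitz bounds -/

theorem proposition2p2 {d : ℕ} (hd : 1 ≤ d) (D : Set (EllipticEVP.Space d))
    (hD_open : IsOpen D) (hD_bdd : Bornology.IsBounded D) (hD_ne : D.Nonempty)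
    (a : ℕ → EllipticEVP.Linf D) (amin amax p : ℝ)
    (hA : EllipticEVP.CoeffAssumption a amin amax p) :
    -- the eigenvalues are well defined and ordered
    EllipticEVP.IsOrderedEigenvalues (EllipticEVP.dirichletForm D) (EllipticEVP.chi D) ∧
    (∀ y ∈ EllipticEVP.paramDomain,
      EllipticEVP.IsOrderedEigenvalues (EllipticEVP.diffusionForm (EllipticEVP.coeff a y))
        (fun k => EllipticEVP.lam a k y)) ∧
    -- the sum in the Lipschitz constant is finite
    (Summable fun j : ℕ => ‖a (j + 1)‖) ∧
    ∀ k : ℕ, 1 ≤ k →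
      -- Lipschitz continuity in the metric of `ℓ^∞`
      (∃ C : ℝ≥0, LipschitzOnWith C (EllipticEVP.lam a k) EllipticEVP.paramDomain) ∧
      -- the explicit bounds
      ∀ y ∈ EllipticEVP.paramDomain, ∀ y' ∈ EllipticEVP.paramDomain,
        |EllipticEVP.lam a k y - EllipticEVP.lam a k y'| ≤
            amax ^ 2 * EllipticEVP.chi D k ^ 2 / (amin ^ 2 * EllipticEVP.chi D 1) *
              ‖EllipticEVP.coeff a y - EllipticEVP.coeff a y'‖ ∧
        amax ^ 2 * EllipticEVP.chi D k ^ 2 / (amin ^ 2 * EllipticEVP.chi D 1) *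
              ‖EllipticEVP.coeff a y - EllipticEVP.coeff a y'‖ ≤
            amax ^ 2 * EllipticEVP.chi D k ^ 2 / (amin ^ 2 * EllipticEVP.chi D 1) *
              (∑' j : ℕ, ‖a (j + 1)‖) * ‖y - y'‖ := by
  have hsum : Summable fun j : ℕ => ‖a (j + 1)‖ :=
    EllipticEVP.summable_of_summable_rpow (fun j => norm_nonneg _) hA.p_pos hA.p_lt_one.le
      hA.summable
  have hE := EllipticEVP.isEnergyForm_dirichletForm hd hD_open hD_bdd
  have hchi := EllipticEVP.isOrderedEigenvalues_eigenvalue hd hD_open hD_bdd hD_ne hE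
  have hχ1 : 0 < EllipticEVP.chi D 1 := hchi.pos
  refine ⟨hchi, fun y hy => ?_, hsum, fun k hk => ?_⟩
  · exact EllipticEVP.isOrderedEigenvalues_eigenvalue hd hD_open hD_bdd hD_ne
      (EllipticEVP.isEnergyForm_diffusionForm hd hD_open hD_bdd hA.amin_pos hA.amin_lt_amax.le
        (hA.bounds y hy))
  have hK : 0 ≤ amax ^ 2 * EllipticEVP.chi D k ^ 2 / (amin ^ 2 * EllipticEVP.chi D 1) := by
    positivity
  have hbound : ∀ y ∈ EllipticEVP.paramDomain, ∀ y' ∈ EllipticEVP.paramDomain,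
      |EllipticEVP.lam a k y - EllipticEVP.lam a k y'| ≤
        amax ^ 2 * EllipticEVP.chi D k ^ 2 / (amin ^ 2 * EllipticEVP.chi D 1) *
          ‖EllipticEVP.coeff a y - EllipticEVP.coeff a y'‖ := fun y hy y' hy' =>
    EllipticEVP.abs_eigenvalue_diffusionForm_sub_le hd hD_open hD_bdd hD_ne hA.amin_pos
      hA.amin_lt_amax.le (hA.bounds y hy) (hA.bounds y' hy') hk
  have hcoeff : ∀ y y' : EllipticEVP.SeqInf,
      amax ^ 2 * EllipticEVP.chi D k ^ 2 / (amin ^ 2 * EllipticEVP.chi D 1) *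
          ‖EllipticEVP.coeff a y - EllipticEVP.coeff a y'‖ ≤
        amax ^ 2 * EllipticEVP.chi D k ^ 2 / (amin ^ 2 * EllipticEVP.chi D 1) *
          (∑' j : ℕ, ‖a (j + 1)‖) * ‖y - y'‖ := fun y y' => by
    rw [mul_assoc _ (∑' j : ℕ, ‖a (j + 1)‖)]
    exact mul_le_mul_of_nonneg_left (EllipticEVP.norm_coeff_sub_le hsum y y') hK
  have hS : 0 ≤ ∑' j : ℕ, ‖a (j + 1)‖ := tsum_nonneg fun j => norm_nonneg _
  refine ⟨⟨⟨_, mul_nonneg hK hS⟩, ?_⟩,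
    fun y hy y' hy' => ⟨hbound y hy y' hy', hcoeff y y'⟩⟩
  refine LipschitzOnWith.of_dist_le_mul fun y hy y' hy' => ?_
  rw [Real.dist_eq, dist_eq_norm]
  exact (hbound y hy y' hy').trans (hcoeff y y')
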